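/- Let $k$ be a field and $S$ a finite-dimensional semisimple $k$-algebra such that $S\otimes_k S^{op}$ is also semisimple. All bimodules are $S$-$S$-bimodules on which $k$ acts centrally, $\otimes=\otimes_S$, gradings are $\mathbb Z$-gradings by sub(bi)modules, and tensor products of homogeneous maps follow the Koszul rule $(f\otimes g)(x\otimes y)=(-1)^{|g||x|}f(x)\otimes g(y)$. For $i_1,\dots,i_r\ge 1$ put $\mathrm{sgn}(i_1,\dots,i_r)=\sum_{u=1}^{r}(r-u)(i_u-1)$. *Algebras.* An $A_\infty$-algebra is a graded $S$-$S$-bimodule $A$ with bimodule morphisms $m_n:A^{\otimes n}\to A$ ($n\ge 1$), homogeneous of degree $2-n$, such that for all $n\ge 1$ $$\sum_{r+s+t=n,\ s\ge 1}(-1)^{r+st}\,m_{r+1+t}(id^{\otimes r}\otimes m_s\otimes id^{\otimes t})=0 .$$ A morphism $f:A\to B$ is a family of bimodule morphisms $f_n:A^{\otimes n}\to B$ ($n\ge1$), homogeneous of degree $1-n$, with $$\sum_{r+s+t=n,\ s\ge 1}(-1)^{r+st}f_{r+1+t}(id^{\otimes r}\otimes m^A_s\otimes id^{\otimes t})=\sum_{i_1+\cdots+i_r=n}(-1)^{\mathrm{sgn}(i_1,\dots,i_r)}m^B_r(f_{i_1}\otimes\cdots\otimes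 f_{i_r})$$ for all $n\ge 1$. Composition is $(g\circ f)_n=\sum_{i_1+\cdots+i_r=n}(-1)^{\mathrm{sgn}(i_1,\dots,i_r)}g_r(f_{i_1}\otimes\cdots\otimes f_{i_r})$; the identity has first component $id_A$ and all others $0$. Morphisms $f,g:A\to B$ are *homotopic* if there are bimodule morphisms $h_n:A^{\otimes n}\to B$ ($n\ge 1$), homogeneous of degree $-n$, such that for all $n\ge1$ $$f_n-g_n=\sum_{r+s+t=n,\ s\ge1}(-1)^{r+st}h_{r+1+t}(id^{\otimes r}\otimes m^A_s\otimes id^{\otimes t})+\sum_{i_1+\cdots+i_r+s+j_1+\cdots+j_t=n}(-1)^{\epsilon}\,m^B_{r+1+t}(f_{i_1}\otimes\cdots\otimes f_{i_r}\otimes h_s\otimes g_{j_1}\otimes\cdots\otimes g_{j_t}),$$ where $r,t\ge 0$, $s,i_u,j_v\ge1$ and $\epsilon=r(t+1)+st+\sum_{1\le u<\alpha\le r}(1-i_u)+t\sum_{u=1}^r i_u+\sum_{1\le v<\beta\le t}(1-j_v)$. A morphism $f:A\to B$ is a *homotopy equivalence* if there is a morphism $g:B\to A$ with $g\circ f$ homotopic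 to $id_A$ and $f\circ g$ homotopic to $id_B$. *Modules.* A right $A_\infty$-module over $A$ is a graded right $S$-module $M$ with morphisms of right $S$-modules $m^M_n:M\otimes A^{\otimes(n-1)}\to M$ ($n\ge1$), homogeneous of degree $2-n$, such that for all $n\ge 1$ $$\sum_{r+s+t=n,\ r,s\ge1}(-1)^{r+st}m^M_{r+1+t}(id^{\otimes r}\otimes m_s\otimes id^{\otimes t})+\sum_{s+t=n,\ s\ge1}(-1)^{st}m^M_{1+t}(m^M_s\otimes id^{\otimes t})=0$$ (here and below, for $r\ge 1$ the first factor of $id^{\otimes r}$ is $id_M$). A morphism $f:M\to N$ is a family of morphisms of right $S$-modules $f_n:M\otimes A^{\otimes(n-1)}\to N$ ($n\ge1$), homogeneous of degree $1-n$, with $$\sum_{r+s+t=n,\ r,s\ge1}(-1)^{r+st}f_{r+1+t}(id^{\otimes r}\otimes m_s\otimes id^{\otimes t})+\sum_{s+t=n,\ s\ge1}(-1)^{st}f_{1+t}(m^M_s\otimes id^{\otimes t})-\sum_{r+s=n,\ r\ge1}(-1)^{(r+1)s}m^N_{1+s}(f_r\otimes id^{\otimes s})=0$$ for all $n\ge1$;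 composition is $(g\circ f)_n=\sum_{r+s=n,\ r\ge1}(-1)^{(r+1)s}g_{1+s}(f_r\otimes id^{\otimes s})$. This is the category $\mathrm{Mod}_\infty\text{-}A$. Morphisms $f,g:M\to N$ are homotopic if there are morphisms of right $S$-modules $h_n:M\otimes A^{\otimes(n-1)}\to N$ ($n\ge1$), homogeneous of degree $-n$, with $$f_n-g_n=\sum_{r+s=n,\ r\ge1}(-1)^{rs}m^N_{1+s}(h_r\otimes id^{\otimes s})+\sum_{s+t=n,\ s\ge1}(-1)^{st}h_{1+t}(m^M_s\otimes id^{\otimes t})+\sum_{r+s+t=n,\ r,s\ge1}(-1)^{r+st}h_{r+1+t}(id^{\otimes r}\otimes m_s\otimes id^{\otimes t})$$ for all $n\ge1$. The homotopy category $\underline{\mathrm{Mod}}_\infty\text{-}A$ is the quotient of $\mathrm{Mod}_\infty\text{-}A$ by this congruence. *Restriction.* A morphism $\phi:A\to B$ of $A_\infty$-algebras induces the restriction functor $R_\phi:\mathrm{Mod}_\infty\text{-}B\to\mathrm{Mod}_\infty\text{-}A$, $R_\phi(M,m^M)=(M,R_\phi(m^M))$, where for a family $f$ of maps $f_n:M\otimes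 B^{\otimes(n-1)}\to N$ (either the operations of a module or the components of a morphism) $R_\phi(f)_1=f_1$ and, for $n\ge 2$, $$R_\phi(f)_n=\sum_{i_1+\cdots+i_r=n-1}(-1)^{\mathrm{sgn}(i_1,\dots,i_r)}f_{r+1}(id_M\otimes\phi_{i_1}\otimes\cdots\otimes\phi_{i_r}).$$ It preserves homotopies and so induces a functor $\underline R_\phi:\underline{\mathrm{Mod}}_\infty\text{-}B\to\underline{\mathrm{Mod}}_\infty\text{-}A$. **Corollary.** Let $A$ and $B$ be $A_\infty$-algebras. 1. If $f,g:A\to B$ are homotopic morphisms of $A_\infty$-algebras, then there is an isomorphism of functors $\underline R_f\cong\underline R_g$. 2. If $f:A\to B$ is a homotopy equivalence of $A_\infty$-algebras, then $\underline R_f:\underline{\mathrm{Mod}}_\infty\text{-}B\to\underline{\mathrm{Mod}}_\infty\text{-}A$ is an equivalence of categories. -/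

import Mathlib

open CategoryTheory MulOpposite

set_option linter.unusedSectionVars false

universe uk us ua ub uc w

namespace AInf

/-! ### Graded abelian groups and the sign operators -/

/-- A `ℤ`-grading of an abelian group: a direct sum decomposition `V = ⨁ j, V_j`. -/
class ZGraded (V : Type*) [AddCommGroup V] where
  gr : ℤ → AddSubgroup V
  isInternal : DirectSum.IsInternal gr

/-- The homogeneous component of degree `j`. -/
abbrev gr {V : Type*} [AddCommGroup V] [ZGraded V] (j : ℤ) : AddSubgroup V := ZGraded.gr j

/-- The sign `(-1)^n`, for `n : ℤ`. -/
abbrev sg (n : ℤ) : ℤˣ := n.negOnePow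

/-- The isomorphism of `V` with the direct sum of its homogeneous components. -/
noncomputable def components (V : Type*) [AddCommGroup V] [ZGraded V] :
    V ≃+ DirectSum ℤ fun j => gr (V := V) j :=
  (AddEquiv.ofBijective (DirectSum.coeAddMonoidHom (gr (V := V)))
    (show Function.Bijective _ from ZGraded.isInternal (V := V))).symm

/-- The Koszul operator: `kos d x = (-1)^(d * |x|) x` for homogeneous `x`, extended additively.
This is the sign that appears when a map of degree `d` is moved past `x`. -/
noncomputable def kos {V : Type*} [AddCommGroup V] [ZGraded V] (d : ℤ) : V →+ V :=
  (DirectSum.toAddMonoid fun j => sg (d * j) • (gr (V := V) j).subtype).comp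
    (components V).toAddMonoidHom

theorem map_sg {V W : Type*} [AddCommGroup V] [AddCommGroup W] (f : V →+ W) (u : ℤˣ) (x : V) :
    f (u • x) = u • f x := by
  rcases Int.units_eq_one_or u with rfl | rfl <;> simp [Units.smul_def]

section Kos

variable {V : Type*} [AddCommGroup V] [ZGraded V]

theorem kos_of_mem (d : ℤ) {j : ℤ} {x : V} (hx : x ∈ gr j) : kos d x = sg (d * j) • x := by
  have h : components V x = DirectSum.of (fun j => (gr (V := V) j)) j ⟨x, hx⟩ := by
    rw [components, AddEquiv.symm_apply_eq]
    exact (DirectSum.coeAddMonoidHom_of (gr (V := V)) j ⟨x, hx⟩).symm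
  change DirectSum.toAddMonoid _ (components V x) = _
  rw [h, DirectSum.toAddMonoid_of]
  rfl

theorem gr_induction {P : V → Prop} (h0 : P 0) (hg : ∀ j, ∀ x ∈ gr j, P x)
    (ha : ∀ x y, P x → P y → P (x + y)) (x : V) : P x := by
  obtain ⟨z, rfl⟩ := (ZGraded.isInternal (V := V)).2 x
  induction z using DirectSum.induction_on with
  | zero => simpa using h0
  | of i x => simpa using hg i x x.2
  | add x y hx hy => simpa using ha _ _ hx hy

theorem units_smul_mem {j : ℤ} {x : V} (u : ℤˣ) (hx : x ∈ gr j) : u • x ∈ gr j := by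
  rcases Int.units_eq_one_or u with rfl | rfl
  · simpa using hx
  · simpa [Units.smul_def] using hx

theorem kos_mem (d : ℤ) {j : ℤ} {x : V} (hx : x ∈ gr j) : kos d x ∈ gr j := by
  rw [kos_of_mem d hx]
  exact units_smul_mem _ hx

theorem sg_congr {a b : ℤ} (h : Even (a - b)) : sg a = sg b := (Int.negOnePow_eq_iff a b).2 h

theorem kos_congr {a b : ℤ} (h : Even (a - b)) (x : V) : kos a x = kos b x := by
  induction x using gr_induction with
  | h0 => simp
  | hg j x hx =>
    rw [kos_of_mem _ hx, kos_of_mem _ hx, sg_congr]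
    rw [← sub_mul]
    exact h.mul_right j
  | ha x y hx hy => simp [hx, hy]

theorem kos_zero (x : V) : kos 0 x = x := by
  induction x using gr_induction with
  | h0 => simp
  | hg j x hx => rw [kos_of_mem _ hx]; simp
  | ha x y hx hy => simp [hx, hy]

theorem kos_kos (a b : ℤ) (x : V) : kos a (kos b x) = kos (a + b) x := by
  induction x using gr_induction with
  | h0 => simp
  | hg j x hx =>
    rw [kos_of_mem b hx, map_sg, kos_of_mem _ hx, kos_of_mem _ hx, smul_smul,
      ← Int.negOnePow_add]
    congr 2; ring
  | ha x y hx hy => simp [hx, hy]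

end Kos

/-! ### Sums over ways of cutting a list -/

section Sums

variable {A B V W : Type*} [AddCommGroup V] [AddCommGroup W]

/-- `cuts l G` is the sum of `G p q` over all ways of writing `l = p ++ q`. -/
def cuts {A V : Type*} [AddCommGroup V] : List A → (List A → List A → V) → V
  | [], G => G [] []
  | a :: l, G => G [] (a :: l) + cuts l fun p q => G (a :: p) q

/-- `blocksSum l G` is the sum of `G [b₁, …, b_r]` over all ways of cutting `l` into consecutive
nonempty blocks, `l = b₁ ++ ⋯ ++ b_r`, i.e. over all compositions `i₁ + ⋯ + i_r` of the length of
`l`, where `i_u` is the length of `b_u`. -/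
def blocksSum {A V : Type*} [AddCommGroup V] (l : List A) (G : List (List A) → V) : V :=
  ∑ c : Composition l.length, G (l.splitWrtComposition c)

theorem cuts_eq_sum (l : List A) (G : List A → List A → V) :
    cuts l G = ∑ i ∈ Finset.range (l.length + 1), G (l.take i) (l.drop i) := by
  induction l generalizing G with
  | nil => simp [cuts]
  | cons a l ih =>
    rw [cuts, ih, Finset.sum_range_succ' _ (a :: l).length]
    simp [add_comm]

theorem cuts_congr {l : List A} {G G' : List A → List A → V}
    (h : ∀ p q, p ++ q = l → G p q = G' p q) : cuts l G = cuts l G' := by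
  rw [cuts_eq_sum, cuts_eq_sum]
  exact Finset.sum_congr rfl fun i _ => h _ _ (List.take_append_drop i l)

theorem cuts_add (l : List A) (G G' : List A → List A → V) :
    (cuts l fun p q => G p q + G' p q) = cuts l G + cuts l G' := by
  simp only [cuts_eq_sum, Finset.sum_add_distrib]

theorem map_cuts (f : V →+ W) (l : List A) (G : List A → List A → V) :
    f (cuts l G) = cuts l fun p q => f (G p q) := by
  simp only [cuts_eq_sum, map_sum]

theorem cuts_smul (u : ℤˣ) (l : List A) (G : List A → List A → V) :
    (cuts l fun p q => u • G p q) = u • cuts l G := by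
  simp only [cuts_eq_sum, Finset.smul_sum]

theorem cuts_zero (l : List A) : (cuts l fun _ _ => (0 : V)) = 0 := by
  simp only [cuts_eq_sum, Finset.sum_const_zero]

theorem cuts_assoc (l : List A) (K : List A → List A → List A → V) :
    (cuts l fun p y => cuts y fun u v => K p u v)
      = cuts l fun P v => cuts P fun p u => K p u v := by
  induction l generalizing K with
  | nil => simp [cuts]
  | cons a l ih => simp only [cuts, cuts_add, ih]; abel

theorem cuts_append (p' : List A) (a : A) (q : List A) (H : List A → List A → V) :
    cuts (p' ++ a :: q) H
      = (cuts p' fun u v => H u (v ++ a :: q)) + cuts q fun u v => H (p' ++ a :: u) v := by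
  induction p' generalizing H with
  | nil => simp [cuts]
  | cons c p' ih => simp only [List.cons_append, cuts, ih]; abel

theorem cuts_mem {l : List A} {G : List A → List A → V} (K : AddSubgroup V)
    (h : ∀ p q, p ++ q = l → G p q ∈ K) : cuts l G ∈ K := by
  rw [cuts_eq_sum]
  exact AddSubgroup.sum_mem _ fun i _ => h _ _ (List.take_append_drop i l)

theorem blocksSum_nil (G : List (List A) → V) : blocksSum [] G = G [] := by
  have : ∀ c : Composition 0, ([] : List A).splitWrtComposition c = [] := by
    intro c
    rw [← List.length_eq_zero_iff, List.length_splitWrtComposition]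
    have := c.length_le
    omega
  unfold blocksSum
  rw [Finset.sum_congr rfl fun c _ => by rw [this c]]
  simp [composition_card]

theorem blocksSum_cons (a : A) (l : List A) (G : List (List A) → V) :
    blocksSum (a :: l) G
      = cuts l fun p q => blocksSum q fun bs => G ((a :: p) :: bs) := by
  rw [cuts_eq_sum]
  unfold blocksSum
  rw [Finset.sum_sigma']
  symm
  refine Finset.sum_bij (fun x hx => (⟨(x.1 + 1) :: x.2.blocks, ?_, ?_⟩ :
    Composition (a :: l).length)) ?_ ?_ ?_ ?_
  · intro i hi
    rcases List.mem_cons.1 hi with rfl | hi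
    · omega
    · exact x.2.blocks_pos hi
  · have h1 := x.2.blocks_sum
    have h2 := (Finset.mem_sigma.1 hx).1
    simp only [Finset.mem_range] at h2
    simp only [List.length_drop] at h1
    simp only [List.sum_cons, h1, List.length_cons]
    omega
  · intro _ _; exact Finset.mem_univ _
  · rintro ⟨i, c⟩ _ ⟨i', c'⟩ _ h
    simp only [Composition.mk.injEq, List.cons.injEq, add_left_inj] at h
    obtain ⟨rfl, h⟩ := h
    congr 1
    exact Composition.ext h
  · rintro ⟨bl, hpos, hsum⟩ _
    cases bl with
    | nil => simp at hsum
    | cons b bl =>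
      have hb : 0 < b := hpos (by simp)
      simp only [List.sum_cons, List.length_cons] at hsum
      refine ⟨⟨b - 1, ⟨bl, fun hi => hpos (List.mem_cons_of_mem _ hi), ?_⟩⟩, ?_, ?_⟩
      · simp only [List.length_drop]; omega
      · simp only [Finset.mem_sigma, Finset.mem_range, Finset.mem_univ, and_true]
        omega
      · exact Composition.ext (by
          change (b - 1 + 1) :: bl = b :: bl
          rw [Nat.sub_add_cancel hb])
  · rintro ⟨i, c⟩ _
    simp [List.splitWrtComposition, List.splitWrtCompositionAux_cons]

theorem blocksSum_congr {l : List A} {G G' : List (List A) → V}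
    (h : ∀ bs, bs.flatten = l → (∀ b ∈ bs, b ≠ []) → G bs = G' bs) :
    blocksSum l G = blocksSum l G' :=
  Finset.sum_congr rfl fun c _ => h _ (List.flatten_splitWrtComposition l c) fun b hb h0 => by
    have := List.length_pos_of_mem_splitWrtComposition hb
    simp [h0] at this

theorem blocksSum_add (l : List A) (G G' : List (List A) → V) :
    (blocksSum l fun bs => G bs + G' bs) = blocksSum l G + blocksSum l G' :=
  Finset.sum_add_distrib

theorem map_blocksSum (f : V →+ W) (l : List A) (G : List (List A) → V) :
    f (blocksSum l G) = blocksSum l fun bs => f (G bs) := by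
  simp only [blocksSum, map_sum]

theorem blocksSum_zero (l : List A) : (blocksSum l fun _ => (0 : V)) = 0 := by
  simp [blocksSum]

theorem blocksSum_cuts (l : List A) (l' : List B) (G : List (List A) → List B → List B → V) :
    (blocksSum l fun bs => cuts l' fun p q => G bs p q)
      = cuts l' fun p q => blocksSum l fun bs => G bs p q := by
  simp only [cuts_eq_sum, blocksSum]
  exact Finset.sum_comm

theorem blocksSum_comm (l : List A) (l' : List B) (G : List (List A) → List (List B) → V) :
    (blocksSum l fun bs => blocksSum l' fun cs => G bs cs)
      = blocksSum l' fun cs => blocksSum l fun bs => G bs cs :=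
  Finset.sum_comm

end Sums

/-! ### Families of maps out of tensor products over `S`

For a right `S`-module `Y`, an `S`-bimodule `A` and a right `S`-module `N`, a family of morphisms of
right `S`-modules `Y ⊗_S A^{⊗ n} → N` (`n ≥ 0`) is encoded, by the universal property of the tensor
product over `S`, by one function `f : Y → List A → N`, whose restriction to lists of length `n` is
the `n`-th map: additive in each variable, `S`-balanced at each tensor sign, and right `S`-linear
in the last variable. -/

section Families

/-- Compatibility of a right `S`-module structure with a grading: the components are
submodules. -/
class IsGradedRight (S V : Type*) [Ring S] [AddCommGroup V] [Module Sᵐᵒᵖ V] [ZGraded V] :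
    Prop where
  op_smul_mem : ∀ (s : S) (j : ℤ) (x : V), x ∈ gr j → op s • x ∈ gr j

/-- Compatibility of a left `S`-module structure with a grading: the components are
submodules. -/
class IsGradedLeft (S V : Type*) [Ring S] [AddCommGroup V] [Module S V] [ZGraded V] :
    Prop where
  smul_mem : ∀ (s : S) (j : ℤ) (x : V), x ∈ gr j → s • x ∈ gr j

/-- The conditions on `f : Y → List A → N` that concern its first variable: additivity, right
`S`-linearity if it is the last variable, and otherwise balancedness with respect to the next. -/
structure SlotLinear (S : Type*) [Ring S] {Y A N : Type*} [AddCommGroup Y] [Module Sᵐᵒᵖ Y]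
    [AddCommGroup A] [Module S A] [AddCommGroup N] [Module Sᵐᵒᵖ N] (f : Y → List A → N) :
    Prop where
  add : ∀ x y l, f (x + y) l = f x l + f y l
  last : ∀ (s : S) x, f (op s • x) [] = op s • f x []
  bal : ∀ (s : S) x a l, f (op s • x) (a :: l) = f x ((s • a) :: l)

/-- The value of `F` on a list of homogeneous elements of degrees `j₁, …, j_n` is homogeneous of
degree `j₁ + ⋯ + j_n + (c - n)`; that is, the `n`-th component of `F` has degree `c - n`. -/
def HasDeg {A V : Type*} [AddCommGroup A] [ZGraded A] [AddCommGroup V] [ZGraded V]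
    (c : ℤ) (F : List A → V) : Prop :=
  ∀ l js, List.Forall₂ (fun a j => a ∈ gr j) l js → F l ∈ gr (js.sum + c - l.length)

/-- `f` is a family of homogeneous morphisms of graded right `S`-modules
`f_n : M ⊗_S A^{⊗ (n-1)} → N`, `n ≥ 1`, of degrees `d + 1 - n`; here `f_n` is the restriction of `f`
to lists of length `n - 1`. -/
structure IsModFamily (S : Type*) [Ring S] {M A N : Type*} [AddCommGroup M] [Module Sᵐᵒᵖ M]
    [ZGraded M] [AddCommGroup A] [Module S A] [Module Sᵐᵒᵖ A] [ZGraded A]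
    [AddCommGroup N] [Module Sᵐᵒᵖ N] [ZGraded N] (d : ℤ) (f : M → List A → N) : Prop where
  fst : SlotLinear S f
  slot : ∀ x p, SlotLinear S fun a q => f x (p ++ a :: q)
  deg : ∀ j x, x ∈ gr j → HasDeg (j + d) (f x)

/-- `F` is a family of homogeneous morphisms of graded `S`-bimodules `F_n : A^{⊗ n} → B`, `n ≥ 1`,
of degrees `c - n`; here `F_n` is the restriction of `F` to lists of length `n`, and the irrelevant
value at the empty list is `0`. -/
structure IsAlgFamily (S : Type*) [Ring S] {A B : Type*} [AddCommGroup A] [Module S A]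
    [Module Sᵐᵒᵖ A] [ZGraded A] [AddCommGroup B] [Module S B] [Module Sᵐᵒᵖ B] [ZGraded B]
    (c : ℤ) (F : List A → B) : Prop where
  nil : F [] = 0
  slot : ∀ p, SlotLinear S fun a q => F (p ++ a :: q)
  left : ∀ (s : S) a l, F ((s • a) :: l) = s • F (a :: l)
  deg : HasDeg c F

end Families

/-! ### Signs and multiadditive functions on lists -/

section MAdd

variable {A B V W : Type*} [AddCommGroup A] [AddCommGroup B] [AddCommGroup V] [AddCommGroup W]

/-- Additivity in every entry of the list. -/
def MAdd {A V : Type*} [AddCommGroup A] [AddCommGroup V] (F : List A → V) : Prop :=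
  ∀ p q x y, F (p ++ (x + y) :: q) = F (p ++ x :: q) + F (p ++ y :: q)

/-- A multiadditive function as an additive function of one entry. -/
def MAdd.hom {F : List A → V} (h : MAdd F) (p q : List A) : A →+ V :=
  AddMonoidHom.mk' (fun x => F (p ++ x :: q)) fun x y => h p q x y

theorem MAdd.sg {F : List A → V} (h : MAdd F) (p q : List A) (u : ℤˣ) (x : A) :
    F (p ++ (u • x) :: q) = u • F (p ++ x :: q) := map_sg (h.hom p q) u x

theorem MAdd.zero {F : List A → V} (h : MAdd F) (p q : List A) : F (p ++ 0 :: q) = 0 :=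
  map_zero (h.hom p q)

theorem MAdd.cons {F : List A → V} (h : MAdd F) (a : A) : MAdd fun l => F (a :: l) :=
  fun p q x y => h (a :: p) q x y

theorem MAdd.neg_map {F : List A → V} (h : MAdd F) (g : A → A) (p z : List A) :
    F (p.map (fun x => -g x) ++ z) = AInf.sg p.length • F (p.map g ++ z) := by
  induction p generalizing F with
  | nil => simp
  | cons a p ih =>
    have h1 := ih (h.cons (-g a))
    have h2 := h.sg [] (p.map g ++ z) (-1) (g a)
    simp only [List.map_cons, List.cons_append, List.nil_append] at h1 h2 ⊢
    rw [h1]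
    have h3 : -g a = (-1 : ℤˣ) • g a := by simp [Units.smul_def]
    rw [h3, h2, smul_smul]
    congr 1
    rw [List.length_cons, Nat.cast_succ, AInf.sg, AInf.sg, Int.negOnePow_succ, mul_neg_one]

variable [ZGraded A]

theorem MAdd.map_kos {F : List A → V} (h : MAdd F) (e : ℤ) (p : List A) (js : List ℤ)
    (hp : List.Forall₂ (fun a j => a ∈ gr j) p js) :
    F (p.map (kos e)) = AInf.sg (e * js.sum) • F p := by
  induction hp generalizing F with
  | nil => simp
  | @cons a j p js ha _ ih =>
    have h1 := ih (h.cons (kos e a))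
    have h2 := h.sg [] p (AInf.sg (e * j)) a
    simp only [List.map_cons, List.nil_append] at h1 h2 ⊢
    rw [h1, kos_of_mem e ha, h2, smul_smul, ← Int.negOnePow_add, List.sum_cons]
    congr 2; ring

variable [ZGraded V]

theorem MAdd.kos {F : List A → V} (h : MAdd F) {c : ℤ} (hc : HasDeg c F) (e : ℤ) (l : List A) :
    kos e (F l) = AInf.sg (e * (c - l.length)) • F (l.map (AInf.kos e)) := by
  suffices H : ∀ q p js, List.Forall₂ (fun a j => a ∈ gr j) p js →
      AInf.kos e (F (p ++ q)) = AInf.sg (e * (c - (p ++ q).length))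
        • F ((p ++ q).map (AInf.kos e)) from H l [] [] .nil
  intro q
  induction q with
  | nil =>
    intro p js hp
    simp only [List.append_nil]
    rw [kos_of_mem e (hc p js hp), h.map_kos e p js hp, smul_smul, ← Int.negOnePow_add]
    congr 2; ring
  | cons a q ih =>
    intro p js hp
    induction a using gr_induction with
    | h0 =>
      simp [h.zero]
    | hg j a ha =>
      have := ih (p ++ [a]) (js ++ [j]) (List.rel_append hp (.cons ha .nil))
      simpa using this
    | ha x y hx hy =>
      have := h (p.map (AInf.kos e)) (q.map (AInf.kos e)) (AInf.kos e x) (AInf.kos e y)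
      simp only [List.map_append, List.map_cons, List.length_append, List.length_cons] at hx hy ⊢
      rw [h, map_add, hx, hy, map_add, this, smul_add]

theorem op_kos {S : Type*} [Ring S] [Module Sᵐᵒᵖ V] [IsGradedRight S V] (s : S) (e : ℤ) (x : V) :
    kos e (op s • x) = op s • kos e x := by
  induction x using gr_induction with
  | h0 => simp
  | hg j x hx =>
    rw [kos_of_mem e hx, kos_of_mem e (IsGradedRight.op_smul_mem s j x hx)]
    exact (map_sg (DistribSMul.toAddMonoidHom V (op s)) _ x).symm
  | ha x y hx hy => simp [hx, hy]

theorem smul_kos {S : Type*} [Ring S] [Module S V] [IsGradedLeft S V] (s : S) (e : ℤ) (x : V) :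
    kos e (s • x) = s • kos e x := by
  induction x using gr_induction with
  | h0 => simp
  | hg j x hx =>
    rw [kos_of_mem e hx, kos_of_mem e (IsGradedLeft.smul_mem s j x hx)]
    exact (map_sg (DistribSMul.toAddMonoidHom V s) _ x).symm
  | ha x y hx hy => simp [hx, hy]

end MAdd

/-! ### The bar construction on lists

Operations without signs, to which the operations of the theory are conjugate under suspension. -/

section Bar

variable {A B C V W : Type*} [AddCommGroup A] [AddCommGroup B] [AddCommGroup C]
  [AddCommGroup V] [AddCommGroup W]

/-- Precomposition with the map of tensor coalgebras determined by `φ`. -/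
def pull {A B V : Type*} [AddCommGroup V] (φ : List A → B) (F : List B → V) (l : List A) : V :=
  blocksSum l fun bs => F (bs.map φ)

theorem pull_nil (φ : List A → B) (F : List B → V) : pull φ F [] = F [] := by
  simp [pull, blocksSum_nil]

theorem pull_cons (φ : List A → B) (F : List B → V) (a : A) (l : List A) :
    pull φ F (a :: l) = cuts l fun p q => pull φ (fun l' => F (φ (a :: p) :: l')) q := by
  simp [pull, blocksSum_cons]

theorem pull_add (φ : List A → B) (F G : List B → V) (l : List A) :
    pull φ (fun l' => F l' + G l') l = pull φ F l + pull φ G l := blocksSum_add _ _ _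

theorem map_pull (f : V →+ W) (φ : List A → B) (F : List B → V) (l : List A) :
    f (pull φ F l) = pull φ (fun l' => f (F l')) l := map_blocksSum _ _ _

theorem pull_cuts' {D : Type*} (φ : List A → B) (l : List A) (l' : List D)
    (G : List B → List D → List D → V) :
    pull φ (fun x => cuts l' fun p q => G x p q) l = cuts l' fun p q => pull φ (fun x => G x p q) l :=
  blocksSum_cuts _ _ _

theorem pull_eq_cuts {φ : List A → B} (h0 : φ [] = 0) {F : List B → V} (hF : MAdd F)
    {l : List A} (hl : l ≠ []) :
    pull φ F l = cuts l fun p q => pull φ (fun l' => F (φ p :: l')) q := by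
  cases l with
  | nil => exact absurd rfl hl
  | cons a l =>
    rw [pull_cons, cuts]
    have : ∀ l', F (φ [] :: l') = 0 := fun l' => by rw [h0]; exact hF.zero [] l'
    simp only [this]
    rw [pull, blocksSum_zero, zero_add]

theorem pull_cuts (φ : List A → B) (H : List B → List B → V) (l : List A) :
    pull φ (fun l' => cuts l' H) l
      = cuts l fun p q => pull φ (fun p' => pull φ (fun q' => H p' q') q) p := by
  induction hn : l.length using Nat.strong_induction_on generalizing l H with
  | _ n ih =>
  cases l with
  | nil => simp [pull_nil, cuts]
  | cons a l =>
    simp only [pull_cons, cuts, pull_add, cuts_add, pull_nil]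
    congr 1
    rw [← cuts_assoc]
    refine cuts_congr fun p q hpq => ?_
    exact ih q.length (by subst hn; subst hpq; simp) (fun u v => H (φ (a :: p) :: u) v) q rfl

theorem pull_pull {φ : List A → B} {ψ : List B → C} {F : List C → V}
    (hF : MAdd F) (l : List A) :
    pull φ (pull ψ F) l = pull (pull φ ψ) F l := by
  induction hn : l.length using Nat.strong_induction_on generalizing l F with
  | _ n ih =>
  cases l with
  | nil => simp [pull_nil]
  | cons a l =>
    have key : ∀ b l', pull ψ F (b :: l')
        = cuts l' fun u v => pull ψ (fun w => F (ψ (b :: u) :: w)) v := fun b l' => pull_cons _ _ _ _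
    rw [pull_cons]
    simp only [key]
    simp only [pull_cuts]
    rw [cuts_assoc, pull_cons (pull φ ψ)]
    refine cuts_congr fun P v hPv => ?_
    have e1 : ∀ c, pull φ (fun v' => pull ψ (fun w => F (c :: w)) v') v
        = pull (pull φ ψ) (fun w => F (c :: w)) v := fun c =>
      ih v.length (by subst hn; subst hPv; simp) (hF.cons c) v rfl
    simp only [e1]
    rw [← pull_cons φ (fun z => pull (pull φ ψ) (fun w => F (ψ z :: w)) v)]
    let f : C →+ V := AddMonoidHom.mk' (fun c => pull (pull φ ψ) (fun w => F (c :: w)) v)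
      fun x y => by
        rw [← pull_add]
        congr 1
        funext w
        exact hF [] w x y
    exact (map_pull f φ ψ (a :: P)).symm

variable [ZGraded A] [ZGraded B]

/-- The sign of the shifted degree. -/
noncomputable def eb {A : Type*} [AddCommGroup A] [ZGraded A] : A →+ A := -kos 1

/-- Precomposition with the coderivation of the tensor coalgebra determined by `b`. -/
noncomputable def codiff {A V : Type*} [AddCommGroup A] [ZGraded A] [AddCommGroup V]
    (b : List A → A) : (List A → V) → List A → V
  | _, [] => 0
  | F, a :: l => (cuts l fun p q => F (b (a :: p) :: q)) + codiff b (fun l' => F (eb a :: l')) l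

theorem codiff_add (b : List A → A) (F G : List A → V) (l : List A) :
    codiff b (fun l' => F l' + G l') l = codiff b F l + codiff b G l := by
  induction l generalizing F G with
  | nil => simp [codiff]
  | cons a l ih => simp only [codiff, cuts_add, ih]; abel

theorem map_codiff (f : V →+ W) (b : List A → A) (F : List A → V) (l : List A) :
    f (codiff b F l) = codiff b (fun l' => f (F l')) l := by
  induction l generalizing F with
  | nil => simp [codiff]
  | cons a l ih => simp only [codiff, map_add, map_cuts, ih]

theorem codiff_zero (b : List A → A) (l : List A) : codiff b (fun _ => (0 : V)) l = 0 := by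
  induction l with
  | nil => simp [codiff]
  | cons a l ih => simp only [codiff, ih, cuts_zero, add_zero]

theorem codiff_congr (b : List A → A) {F G : List A → V} (h : ∀ l, l ≠ [] → F l = G l)
    (l : List A) : codiff b F l = codiff b G l := by
  cases l with
  | nil => simp [codiff]
  | cons a l => simp [codiff, h]

theorem codiff_eq_cuts (b : List A → A) (F : List A → V) (l : List A) :
    codiff b F l = cuts l fun p y => cuts y fun c q =>
      if c = [] then 0 else F (p.map eb ++ b c :: q) := by
  induction l generalizing F with
  | nil => simp [codiff, cuts]
  | cons a l ih => simp [codiff, cuts, ih]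

theorem codiff_cuts (b : List A → A) (H : List A → List A → V) (l : List A) :
    codiff b (fun l' => cuts l' H) l
      = cuts l fun p q => codiff b (fun p' => H p' q) p + codiff b (fun q' => H (p.map eb) q') q := by
  induction l generalizing H with
  | nil => simp [codiff, cuts]
  | cons a l ih =>
    simp only [codiff, cuts, codiff_add, cuts_add, ih, List.map_nil, List.map_cons]
    rw [cuts_assoc]
    abel

theorem codiff_pull {φ : List A → B} {b : List A → A} {b' : List B → B}
    (h0 : φ [] = 0) (hφ : ∀ l, φ (l.map eb) = eb (φ l))
    (hc : ∀ l, codiff b φ l = pull φ b' l) {F : List B → V} (hF : MAdd F) (l : List A) :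
    codiff b (pull φ F) l = pull φ (codiff b' F) l := by
  induction hn : l.length using Nat.strong_induction_on generalizing l F with
  | _ n ih =>
  cases l with
  | nil => simp [codiff, pull_nil]
  | cons a l =>
    have hadd : ∀ v, ∃ f : B →+ V, ∀ c, f c = pull φ (fun w => F (c :: w)) v := fun v =>
      ⟨AddMonoidHom.mk' (fun c => pull φ (fun w => F (c :: w)) v) fun x y => by
        rw [← pull_add]
        congr 1
        funext w
        exact hF [] w x y, fun _ => rfl⟩
    rw [codiff_congr b (fun l' hl' => pull_eq_cuts h0 hF hl'), codiff_cuts]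
    rw [pull_cons]
    simp only [codiff, pull_add, cuts_add, pull_cuts, cuts]
    rw [cuts_assoc]
    simp only [List.map_nil, h0, zero_add]
    have z : ∀ l : List A, codiff b (fun q' => pull φ (fun l' => F (0 :: l')) q') l = (0 : V) := by
      intro l
      have : ∀ q', pull φ (fun l' => F (0 :: l')) q' = (0 : V) := fun q' => by
        have : ∀ l', F (0 :: l') = 0 := fun l' => hF.zero [] l'
        simp only [this]
        exact blocksSum_zero _
      simp only [this]
      exact codiff_zero b l
    have z' := z (a :: l)
    simp only [codiff] at z'
    rw [z', zero_add]
    congr 1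
    · rw [← cuts_add]
      refine cuts_congr fun P v hPv => ?_
      obtain ⟨f, hf⟩ := hadd v
      have e1 := map_codiff f b φ (a :: P)
      have e2 := map_pull f φ b' (a :: P)
      simp only [hf] at e1 e2
      rw [← hc, e1] at e2
      rw [codiff] at e2
      rw [e2, pull_cons]
    · refine cuts_congr fun P v hPv => ?_
      rw [← ih v.length (by subst hn; subst hPv; simp) (hF.cons _) v rfl]
      rw [hφ]

end Bar

/-! ### The signed operations of the theory -/

section Operations

variable {A B M N L : Type*} [AddCommGroup A] [ZGraded A] [AddCommGroup B] [ZGraded B]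
  [AddCommGroup M] [ZGraded M] [AddCommGroup N] [ZGraded N] [AddCommGroup L] [ZGraded L]

/-- The degree `(1 - i₁) + ⋯ + (1 - i_r)` of `φ_{i₁} ⊗ ⋯ ⊗ φ_{i_r}`, where `φ_i` has degree `1 - i`
and `i_u` is the length of the `u`-th block. -/
def degSum (bs : List (List A)) : ℤ := (bs.map fun b => (1 : ℤ) - b.length).sum

/-- `sgn(i₁, …, i_r) = (r-1)(i₁-1) + (r-2)(i₂-1) + ⋯ + (i_{r-1}-1)`, where `i_u` is the length of
the `u`-th block. -/
def blockSign : List (List A) → ℤ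
  | [] => 0
  | b :: bs => bs.length * ((b.length : ℤ) - 1) + blockSign bs

/-- `φ_{i₁} ⊗ ⋯ ⊗ φ_{i_r} ⊗ ψ` applied to the blocks `b₁, …, b_r`, of lengths `i₁, …, i_r`, and
something else, to which a map `ψ` of degree `e` is applied; here `φ_i` has degree `1 - i`. The
result is the list of the first `r` tensor factors, including all Koszul signs. -/
noncomputable def tens (φ : List A → B) (e : ℤ) : List (List A) → List B
  | [] => []
  | b :: bs => φ (b.map (kos (degSum bs + e))) :: tens φ e bs

/-- `∑_{r+s+t=n, s≥1} (-1)^{r+st} F_{r+1+t} (id^{⊗r} ⊗ m_s ⊗ id^{⊗t})`, evaluated at a list `l` of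
length `n`, where `m_s` has degree `2 - s`. -/
noncomputable def algInsert (m : List A → A) (F : List A → B) (l : List A) : B :=
  cuts l fun p y => cuts y fun b q => if b = [] then 0 else
    sg (p.length + b.length * q.length) • F (p.map (kos (2 - b.length)) ++ m b :: q)

/-- `∑_{i₁+⋯+i_r=n} (-1)^{sgn(i₁,…,i_r)} G_r (φ_{i₁} ⊗ ⋯ ⊗ φ_{i_r})`, evaluated at a list `l` of
length `n`, where `φ_i` has degree `1 - i`. -/
noncomputable def algComp {V : Type*} [AddCommGroup V] (G : List B → V) (φ : List A → B)
    (l : List A) : V :=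
  blocksSum l fun bs => sg (blockSign bs) • G (tens φ 0 bs)

/-- The composition of `g` with a family `f` of degree `d`,
`(g ∘ f)_n = ∑_{r+s=n, r≥1} (-1)^{(d+r+1)s} g_{1+s} (f_r ⊗ id^{⊗s})`. -/
noncomputable def modComp (d : ℤ) (g : N → List A → L) (f : M → List A → N)
    (x : M) (l : List A) : L :=
  cuts l fun p q => sg ((d + (p.length + 1) + 1) * q.length) • g (f x p) q

/-- The differential of a family `f` of degree `d`,
`δ(f)_n = ∑_{r+s+t=n, r,s≥1} (-1)^{d+r+st+1} f_{r+1+t} (id^{⊗r} ⊗ m_s ⊗ id^{⊗t})`; the first of the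
`r` variables on the left is the one in `M`. -/
noncomputable def modDiff (m : List A → A) (d : ℤ) (f : M → List A → N)
    (x : M) (l : List A) : N :=
  cuts l fun p y => cuts y fun b q => if b = [] then 0 else
    sg (d + (p.length + 1) + b.length * q.length + 1)
      • f (kos (2 - b.length) x) (p.map (kos (2 - b.length)) ++ m b :: q)

/-- The restriction of a family along `φ`,
`R_φ(f)_n = ∑_{i₁+⋯+i_r=n-1} (-1)^{sgn(i₁,…,i_r)} f_{r+1} (id ⊗ φ_{i₁} ⊗ ⋯ ⊗ φ_{i_r})` (which is
`f₁` for `n = 1`). -/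
noncomputable def modRestrict (φ : List A → B) (f : M → List B → N) (x : M) (l : List A) : N :=
  blocksSum l fun bs => sg (blockSign bs) • f (kos (degSum bs) x) (tens φ 0 bs)

/-- The sum `H_{f,g}(h)_n` over `i₁+⋯+i_r+s+j₁+⋯+j_t = n` of
`(-1)^{sgn} m_{r+1+t} (f_{i₁} ⊗ ⋯ ⊗ f_{i_r} ⊗ h_s ⊗ g_{j₁} ⊗ ⋯ ⊗ g_{j_t})`, evaluated at a list
of length `n`, where `h_s` has degree `-s` and `sgn` is
`r(t+1) + st + ∑_{1≤u<α≤r} (1-i_u) + t ∑_u i_u + ∑_{1≤v<β≤t} (1-j_v)`; the two sums over pairs are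
`-sgn(i₁,…,i_r)` and `-sgn(j₁,…,j_t)`. -/
noncomputable def algHomotopySum (m : List B → B) (f g h : List A → B) (l : List A) : B :=
  cuts l fun p y => cuts y fun x q => if x = [] then 0 else
    blocksSum p fun bs => blocksSum q fun cs =>
      sg (bs.length * (cs.length + 1) + x.length * cs.length - blockSign bs
          + cs.length * p.length - blockSign cs)
        • m (tens f (-x.length + degSum cs) bs ++ h (x.map (kos (degSum cs))) :: tens g 0 cs)

end Operations

/-! ### Suspension -/

section Suspension

variable {A B M N L V : Type*} [AddCommGroup A] [ZGraded A] [AddCommGroup B] [ZGraded B]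
  [AddCommGroup M] [ZGraded M] [AddCommGroup N] [ZGraded N] [AddCommGroup L] [AddCommGroup V]

theorem map_kos_map (a b : ℤ) (l : List A) :
    (l.map (kos a)).map (kos b) = l.map (kos (b + a)) := by
  simp [List.map_map, Function.comp_def, kos_kos]

theorem map_kos_congr {a b : ℤ} (h : Even (a - b)) (l : List A) :
    l.map (kos a) = l.map (kos b) :=
  List.map_congr_left fun x _ => kos_congr h x

theorem map_kos_even {a : ℤ} (h : Even a) (l : List A) : l.map (kos a) = l := by
  rw [map_kos_congr (b := 0) (by simpa using h)]
  conv_rhs => rw [← List.map_id l]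
  exact List.map_congr_left fun x _ => kos_zero x

/-- The signs in `σ ⊗ ⋯ ⊗ σ` for the suspension `σ` of degree `-1`. -/
noncomputable def theta {A : Type*} [AddCommGroup A] [ZGraded A] : List A → List A
  | [] => []
  | a :: l => kos l.length a :: theta l

theorem theta_length (l : List A) : (theta l).length = l.length := by
  induction l with
  | nil => rfl
  | cons a l ih => simp [theta, ih]

theorem theta_append (p q : List A) :
    theta (p ++ q) = (theta p).map (kos q.length) ++ theta q := by
  induction p with
  | nil => rfl
  | cons a p ih =>
    simp only [List.cons_append, theta, ih, List.map_cons, kos_kos, List.length_append]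
    rw [kos_congr]
    push_cast; ring_nf; exact Even.zero

theorem theta_map_kos (d : ℤ) (l : List A) : theta (l.map (kos d)) = (theta l).map (kos d) := by
  induction l with
  | nil => rfl
  | cons a l ih => simp [theta, ih, kos_kos, add_comm]

theorem theta_theta (l : List A) : theta (theta l) = l := by
  induction l with
  | nil => rfl
  | cons a l ih =>
    simp only [theta, ih, theta_length, kos_kos]
    rw [kos_congr (b := 0) (by simp), kos_zero]

theorem theta_map_eb (l : List A) : theta (l.map eb) = (theta l).map eb := by
  induction l with
  | nil => rfl
  | cons a l ih =>
    simp only [theta, List.map_cons, ih, List.length_map]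
    simp [eb, kos_kos, add_comm]

theorem cuts_theta (l : List A) (G : List A → List A → V) :
    cuts (theta l) G = cuts l fun p q => G ((theta p).map (kos q.length)) (theta q) := by
  induction l generalizing G with
  | nil => simp [theta, cuts]
  | cons a l ih =>
    simp only [theta, cuts, ih, List.map_nil, List.map_cons, kos_kos]
    congr 1
    refine cuts_congr fun p q hpq => ?_
    rw [kos_congr]
    subst hpq
    simp [add_comm]

/-- The signs of suspension on a list cut into blocks. -/
noncomputable def Theta {A : Type*} [AddCommGroup A] [ZGraded A] : List (List A) → List (List A)
  | [] => []
  | b :: bs => (theta b).map (kos bs.flatten.length) :: Theta bs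

theorem Theta_length (bs : List (List A)) : (Theta bs).length = bs.length := by
  induction bs with
  | nil => rfl
  | cons b bs ih => simp [Theta, ih]

theorem blocksSum_theta (l : List A) (G : List (List A) → V) :
    blocksSum (theta l) G = blocksSum l fun bs => G (Theta bs) := by
  induction hn : l.length using Nat.strong_induction_on generalizing l G with
  | _ n ih =>
  cases l with
  | nil => simp [theta, blocksSum_nil, Theta]
  | cons a l =>
    simp only [theta, blocksSum_cons, cuts_theta]
    refine cuts_congr fun p q hpq => ?_
    rw [ih q.length (by subst hn; subst hpq; simp) q _ rfl]
    refine blocksSum_congr fun bs hbs _ => ?_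
    simp only [Theta, theta, List.map_cons, kos_kos, hbs]
    rw [kos_congr]
    subst hpq
    simp [add_comm]

theorem degSum_eq (bs : List (List A)) : degSum bs = bs.length - bs.flatten.length := by
  induction bs with
  | nil => rfl
  | cons b bs ih =>
    simp only [degSum, List.map_cons, List.sum_cons, List.length_cons, List.flatten_cons,
      List.length_append] at ih ⊢
    rw [ih]; push_cast; ring

/-- Suspension of a family of maps of algebra type. -/
noncomputable def twA {A V : Type*} [AddCommGroup A] [ZGraded A] (F : List A → V) (l : List A) :
    V := F (theta l)

/-- Suspension of a family of maps of module type. -/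
noncomputable def twM {M A V : Type*} [AddCommGroup M] [ZGraded M] [AddCommGroup A] [ZGraded A]
    (f : M → List A → V) (x : M) (l : List A) : V := f (kos l.length x) (theta l)

theorem insert_term {F : List A → V} (hF : MAdd F) {m : List A → A} (hm : MAdd m)
    (hd : HasDeg 2 m) (p c q : List A) :
    F (theta ((((theta p).map (kos (c.length + q.length))).map eb)
        ++ twA m ((theta c).map (kos q.length)) :: theta q))
      = sg (p.length + c.length * q.length)
        • F (p.map (kos (2 - c.length)) ++ m c :: q) := by
  have e1 : kos q.length (twA m ((theta c).map (kos q.length)))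
      = sg (c.length * q.length) • m c := by
    rw [twA, theta_map_kos, theta_theta, hm.kos hd, map_kos_map,
      map_kos_even (a := q.length + q.length) ⟨_, rfl⟩]
    congr 1
    apply sg_congr
    simp only [List.length_map]
    exact ⟨q.length * (1 - c.length), by ring⟩
  have e2 : (theta (((theta p).map (kos (c.length + q.length))).map eb)).map
      (kos (q.length + 1)) = p.map fun x => -kos (2 - c.length) x := by
    rw [theta_map_eb, theta_map_kos, theta_theta]
    simp only [List.map_map]
    refine List.map_congr_left fun x _ => ?_
    simp only [Function.comp_apply, eb, AddMonoidHom.neg_apply, map_neg, kos_kos]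
    rw [kos_congr]
    exact ⟨q.length + c.length, by ring⟩
  rw [theta_append]
  simp only [theta, theta_theta, theta_length, List.length_cons, Nat.cast_add, Nat.cast_one]
  rw [e1, e2, hF.neg_map, hF.sg, smul_smul, ← Int.negOnePow_add]

theorem algInsert_eq {F : List A → V} (hF : MAdd F) {m : List A → A} (hm : MAdd m)
    (hd : HasDeg 2 m) (l : List A) : codiff (twA m) (twA F) (theta l)
      = cuts l fun p y => cuts y fun b q => if b = [] then 0 else
        sg (p.length + b.length * q.length) • F (p.map (kos (2 - b.length)) ++ m b :: q) := by
  rw [codiff_eq_cuts, cuts_theta]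
  refine cuts_congr fun p y _ => ?_
  rw [cuts_theta]
  refine cuts_congr fun c q hcq => ?_
  have h0 : ((theta c).map (kos q.length) = []) ↔ c = [] := by
    simp only [← List.length_eq_zero_iff, List.length_map, theta_length]
  by_cases hc : c = []
  · rw [if_pos (h0.2 hc), if_pos hc]
  · rw [if_neg (fun h => hc (h0.1 h)), if_neg hc, ← insert_term hF hm hd]
    subst hcq
    simp [twA]

theorem modDiff_eq {f : M → List A → N} (hx : ∀ x, MAdd (f x))
    (hadd : ∀ x y l, f (x + y) l = f x l + f y l) {m : List A → A} (hm : MAdd m)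
    (hd : HasDeg 2 m) (d : ℤ) (x : M) (l : List A) :
    modDiff m d f x l
      = sg (d + 1) • codiff (twA m) (twM f (eb (kos l.length x))) (theta l) := by
  rw [codiff_eq_cuts, cuts_theta, modDiff, ← cuts_smul]
  refine cuts_congr fun p y hpy => ?_
  rw [cuts_theta, ← cuts_smul]
  refine cuts_congr fun c q hcq => ?_
  have h0 : ((theta c).map (kos q.length) = []) ↔ c = [] := by
    simp only [← List.length_eq_zero_iff, List.length_map, theta_length]
  by_cases hc : c = []
  · rw [if_pos (h0.2 hc), if_pos hc, smul_zero]
  · rw [if_neg (fun h => hc (h0.1 h)), if_neg hc]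
    have key := insert_term (hx (kos (2 - c.length) x)) hm hd p c q
    have hneg : ∀ z L, f (-z) L = -f z L := fun z L =>
      map_neg (AddMonoidHom.mk' (fun z => f z L) fun a b => hadd a b L) z
    have e : ∀ (L : List A), L.length = p.length + 1 + q.length →
        kos L.length (eb (kos l.length x)) = -kos (2 - c.length) x := by
      intro L hL
      simp only [eb, AddMonoidHom.neg_apply, map_neg, kos_kos]
      rw [kos_congr]
      subst hcq; subst hpy
      rw [hL]
      simp only [List.length_append]
      exact ⟨p.length + q.length + c.length, by push_cast; ring⟩
    have hy : (y.length : ℤ) = c.length + q.length := by subst hcq; simp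
    rw [hy, twM, e _ (by simp [theta_length]; ring), hneg, key, smul_neg, smul_smul,
      ← Int.negOnePow_add, ← Units.neg_smul, ← Int.negOnePow_succ]
    congr 1
    apply sg_congr
    exact ⟨0, by ring⟩

theorem modComp_eq {f : M → List A → N} {d : ℤ}
    (hk : ∀ e x l, kos e (f x l) = sg (e * (d - l.length)) • f (kos e x) (l.map (kos e)))
    {g : N → List A → L} (hadd : ∀ x y l, g (x + y) l = g x l + g y l) (x : M) (l : List A) :
    modComp d g f x l
      = cuts (theta l) fun p q => twM g (twM f (kos l.length x) p) q := by
  rw [cuts_theta, modComp]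
  refine cuts_congr fun p q hpq => ?_
  have hsg : ∀ (u : ℤˣ) z L, g (u • z) L = u • g z L := fun u z L =>
    map_sg (AddMonoidHom.mk' (fun z => g z L) fun a b => hadd a b L) u z
  simp only [twM, List.length_map, theta_length, theta_map_kos, theta_theta, kos_kos]
  rw [hk, hsg, map_kos_map,
      map_kos_even (a := q.length + q.length) ⟨_, rfl⟩, kos_kos, kos_congr (b := 0), kos_zero]
  · congr 1
    apply sg_congr
    simp only [List.length_map]
    exact ⟨q.length * (p.length + 1), by ring⟩
  · subst hpq
    simp only [List.length_append]
    exact ⟨q.length + p.length, by push_cast; ring⟩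

theorem blocks_term {F : List B → V} (hF : MAdd F) {φ : List A → B} (hφ : MAdd φ)
    (hd : HasDeg 1 φ) (bs : List (List A)) :
    F (theta ((Theta bs).map (twA φ))) = sg (blockSign bs) • F (tens φ 0 bs) := by
  induction bs generalizing F with
  | nil => simp [Theta, theta, blockSign, tens]
  | cons b bs ih =>
    simp only [Theta, List.map_cons, theta, List.length_map, Theta_length, tens, blockSign]
    rw [twA, theta_map_kos, theta_theta, hφ.kos hd, map_kos_map,
      map_kos_congr (a := bs.length + bs.flatten.length) (b := degSum bs + 0)]
    · rw [ih (hF.cons _)]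
      have := hF.sg [] (tens φ 0 bs) (sg (bs.length * (1 - (b.map (kos bs.flatten.length)).length)))
        (φ (b.map (kos (degSum bs + 0))))
      simp only [List.nil_append] at this
      rw [this, smul_smul, ← Int.negOnePow_add]
      congr 1
      apply sg_congr
      simp only [List.length_map]
      exact ⟨bs.length * (1 - (b.length : ℤ)), by ring⟩
    · rw [degSum_eq]
      exact ⟨bs.flatten.length, by ring⟩

theorem algComp_eq {G : List B → V} (hG : MAdd G) {φ : List A → B} (hφ : MAdd φ)
    (hd : HasDeg 1 φ) (l : List A) : algComp G φ l = pull (twA φ) (twA G) (theta l) := by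
  rw [pull, blocksSum_theta, algComp]
  exact blocksSum_congr fun bs _ _ => (blocks_term hG hφ hd bs).symm

theorem modRestrict_eq {f : M → List B → N} (hx : ∀ x, MAdd (f x)) {φ : List A → B}
    (hφ : MAdd φ) (hd : HasDeg 1 φ) (x : M) (l : List A) :
    modRestrict φ f x l = pull (twA φ) (twM f (kos l.length x)) (theta l) := by
  rw [pull, blocksSum_theta, modRestrict]
  refine blocksSum_congr fun bs hbs _ => ?_
  rw [twM, blocks_term (hx _) hφ hd, kos_kos, kos_congr]
  rw [degSum_eq, hbs, List.length_map, Theta_length]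
  exact ⟨-l.length, by ring⟩

end Suspension

/-! ### Closure properties -/

section Closure

variable {S : Type*} [Ring S]
variable {Y Z A B N : Type*} [AddCommGroup Y] [Module Sᵐᵒᵖ Y] [AddCommGroup Z] [Module Sᵐᵒᵖ Z]
  [AddCommGroup A] [Module S A] [Module Sᵐᵒᵖ A] [AddCommGroup B] [Module S B] [Module Sᵐᵒᵖ B]
  [AddCommGroup N] [Module Sᵐᵒᵖ N]

theorem SlotLinear.sum {f g : Y → List A → N} (hf : SlotLinear S f) (hg : SlotLinear S g) :
    SlotLinear S fun y l => f y l + g y l where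
  add x y l := by simp only [hf.add, hg.add]; abel
  last s x := by simp only [hf.last, hg.last, smul_add]
  bal s x a l := by simp only [hf.bal, hg.bal]

theorem SlotLinear.neg {f : Y → List A → N} (hf : SlotLinear S f) :
    SlotLinear S fun y l => -f y l where
  add x y l := by simp only [hf.add]; abel
  last s x := by simp only [hf.last, smul_neg]
  bal s x a l := by simp only [hf.bal]

theorem SlotLinear.zero : SlotLinear S fun (_ : Y) (_ : List A) => (0 : N) where
  add x y l := by simp
  last s x := by simp
  bal s x a l := rfl

theorem SlotLinear.cuts {D : Type*} (p : List D) {K : List D → List D → Y → List A → N}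
    (h : ∀ u v, SlotLinear S (K u v)) :
    SlotLinear S fun y l => AInf.cuts p fun u v => K u v y l where
  add x y l := by simp only [(h _ _).add, cuts_add]
  last s x := by
    simp only [(h _ _).last]
    exact (map_cuts (DistribSMul.toAddMonoidHom N (op s)) _ _).symm
  bal s x a l := by simp only [(h _ _).bal]

theorem SlotLinear.comp {g : Z → List A → N} {f : Y → List A → Z} (hg : SlotLinear S g)
    (hf : SlotLinear S f) : SlotLinear S fun y l => AInf.cuts l fun p q => g (f y p) q where
  add x y l := by simp only [hf.add, hg.add, cuts_add]
  last s x := by simp only [AInf.cuts, hf.last, hg.last]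
  bal s x a l := by simp only [AInf.cuts, hf.last, hf.bal, hg.bal]

theorem SlotLinear.pull {f : Y → List B → N} (hf : SlotLinear S f) {φ : List A → B}
    (hφ : ∀ (s : S) a l, φ ((s • a) :: l) = s • φ (a :: l)) :
    SlotLinear S fun y l => AInf.pull φ (f y) l where
  add x y l := by simp only [← pull_add, ← hf.add]
  last s x := by simp only [pull_nil, hf.last]
  bal s x a l := by simp only [pull_cons, hf.bal, hφ]

theorem slot_pull {φ : List A → B} (hs : ∀ p, SlotLinear S fun a q => φ (p ++ a :: q))
    (hφ : ∀ (s : S) a l, φ ((s • a) :: l) = s • φ (a :: l)) {F : List B → N}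
    (hF : ∀ p, SlotLinear S fun a q => F (p ++ a :: q)) (p : List A) :
    SlotLinear S fun a q => pull φ F (p ++ a :: q) := by
  induction hn : p.length using Nat.strong_induction_on generalizing p F with
  | _ n ih =>
  have hz : SlotLinear S fun z v => pull φ (fun l' => F (z :: l')) v := (hF []).pull hφ
  have hF' : ∀ b p, SlotLinear S fun a q => F (b :: (p ++ a :: q)) := fun b p => hF (b :: p)
  cases p with
  | nil =>
    simp only [List.nil_append, pull_cons]
    exact hz.comp (hs [])
  | cons c p =>
    simp only [List.cons_append, pull_cons, cuts_append]
    refine SlotLinear.sum ?_ (hz.comp (hs (c :: p)))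
    rw [show (fun (a : A) q => cuts p fun u v => pull φ (fun l' => F (φ (c :: u) :: l'))
        (v ++ a :: q)) = fun a q => ∑ i ∈ Finset.range (p.length + 1),
          pull φ (fun l' => F (φ (c :: p.take i) :: l')) (p.drop i ++ a :: q) from by
      funext a q; exact cuts_eq_sum _ _]
    have : ∀ i, SlotLinear S fun a q =>
        pull φ (fun l' => F (φ (c :: p.take i) :: l')) (p.drop i ++ a :: q) := fun i =>
      ih (p.drop i).length (by subst hn; simp) (hF' _) _ rfl
    exact {
      add := fun x y l => by simp only [(this _).add, Finset.sum_add_distrib]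
      last := fun s x => by simp only [(this _).last, Finset.smul_sum]
      bal := fun s x a l => by simp only [(this _).bal] }

theorem MAdd_of_slot {F : List A → N} (h : ∀ p, SlotLinear S fun a q => F (p ++ a :: q)) :
    MAdd F := fun p q x y => (h p).add x y q

variable [ZGraded Y] [ZGraded Z] [ZGraded A] [ZGraded B] [ZGraded N]

theorem forall₂_theta {l : List A} {js : List ℤ}
    (h : List.Forall₂ (fun a j => a ∈ gr j) l js) :
    List.Forall₂ (fun a j => a ∈ gr j) (theta l) js := by
  induction h with
  | nil => exact .nil
  | cons ha _ ih => exact .cons (kos_mem _ ha) ih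

theorem forall₂_split {p q : List A} {js : List ℤ}
    (h : List.Forall₂ (fun a j => a ∈ gr j) (p ++ q) js) :
    ∃ j₁ j₂, js = j₁ ++ j₂ ∧ List.Forall₂ (fun a j => a ∈ gr j) p j₁ ∧
      List.Forall₂ (fun a j => a ∈ gr j) q j₂ := by
  induction p generalizing js with
  | nil => exact ⟨[], js, rfl, .nil, h⟩
  | cons a p ih =>
    cases h with
    | @cons _ j _ js ha h =>
      obtain ⟨j₁, j₂, rfl, h₁, h₂⟩ := ih h
      exact ⟨j :: j₁, j₂, rfl, .cons ha h₁, h₂⟩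

theorem gr_cast {i j : ℤ} {x : A} (h : x ∈ gr i) (e : i = j) : x ∈ gr j := e ▸ h

theorem HasDeg.twA {c : ℤ} {F : List A → N} (h : HasDeg c F) : HasDeg c (AInf.twA F) :=
  fun l js hl => gr_cast (h _ js (forall₂_theta hl)) (by rw [theta_length])

theorem HasDeg.pull {c : ℤ} {φ : List A → B} (hφ : HasDeg 1 φ) {F : List B → N}
    (hF : HasDeg c F) : HasDeg c (AInf.pull φ F) := by
  intro l js hl
  induction hn : l.length using Nat.strong_induction_on generalizing l js c F with
  | _ n ih =>
  cases hl with
  | nil => rw [pull_nil]; exact gr_cast (hF [] [] .nil) (by subst hn; simp)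
  | @cons a j l js ha hl =>
    rw [pull_cons]
    refine cuts_mem _ fun p q hpq => ?_
    subst hpq
    obtain ⟨j₁, j₂, rfl, h₁, h₂⟩ := forall₂_split hl
    have hb := hφ (a :: p) (j :: j₁) (.cons ha h₁)
    have hF' : HasDeg (c - 1 + ((j :: j₁).sum + 1 - (a :: p).length))
        fun l' => F (φ (a :: p) :: l') := fun l' js' hl' =>
      gr_cast (hF _ _ (.cons hb hl')) (by simp; ring)
    refine gr_cast (ih q.length (by subst hn; simp) hF' q j₂ h₂ rfl) ?_
    subst hn
    simp
    ring

variable [IsGradedRight S Y] [IsGradedRight S Z] [IsGradedRight S A] [IsGradedLeft S A]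
  [IsGradedRight S B] [IsGradedLeft S B]

theorem SlotLinear.twM {f : Y → List A → N} (hf : SlotLinear S f) :
    SlotLinear S (AInf.twM f) where
  add x y l := by simp only [AInf.twM, map_add, hf.add]
  last s x := by simp only [AInf.twM, op_kos, theta, hf.last]
  bal s x a l := by
    simp only [AInf.twM, op_kos, theta, hf.bal, smul_kos, List.length_cons]

theorem slot_theta {F : List A → N} (h : ∀ p, SlotLinear S fun a q => F (p ++ a :: q))
    (p : List A) : SlotLinear S fun a q => F (theta (p ++ a :: q)) := by
  have e : ∀ a q, F (theta (p ++ a :: q))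
      = F ((theta p).map (kos (q.length + 1)) ++ kos q.length a :: theta q) := fun a q => by
    rw [theta_append]; simp [theta]
  simp only [e]
  exact {
    add := fun x y l => by
      rw [map_add]
      exact (h _).add _ _ _
    last := fun s x => by
      rw [op_kos]
      exact (h _).last s _
    bal := fun s x a l => by
      rw [op_kos]
      simp only [List.length_cons, theta, smul_kos]
      exact (h _).bal s _ _ _ }

theorem IsAlgFamily.twA {c : ℤ} {F : List A → B} (h : IsAlgFamily S c F) :
    IsAlgFamily S c (AInf.twA F) where
  nil := h.nil
  slot := slot_theta h.slot
  left s a l := by simp only [AInf.twA, theta, smul_kos, h.left]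
  deg := h.deg.twA

theorem IsModFamily.twM {d : ℤ} {f : Y → List A → N} (h : IsModFamily S d f) :
    IsModFamily S d (AInf.twM f) where
  fst := h.fst.twM
  slot x p := by
    have : ∀ a q, AInf.twM f x (p ++ a :: q)
        = f (kos (p.length + 1 + q.length) x) (theta (p ++ a :: q)) := fun a q => by
      rw [AInf.twM]; congr 3; simp; ring
    simp only [this]
    have h' := fun x => slot_theta (h.slot x) p
    exact {
      add := fun a b l => (h' _).add a b l
      last := fun s a => (h' _).last s a
      bal := fun s a b l => by
        simp only [List.length_cons]
        exact (h' _).bal s a b l }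
  deg j x hx l js hl :=
    gr_cast (h.deg j _ (kos_mem l.length hx) _ js (forall₂_theta hl)) (by rw [theta_length])

theorem IsAlgFamily.mAdd {c : ℤ} {F : List A → B} (h : IsAlgFamily S c F) : MAdd F :=
  MAdd_of_slot h.slot

theorem IsModFamily.mAdd {d : ℤ} {f : Y → List A → N} (h : IsModFamily S d f) (x : Y) :
    MAdd (f x) := MAdd_of_slot (h.slot x)

theorem IsModFamily.kos {d : ℤ} {f : Y → List A → N} (h : IsModFamily S d f) (e : ℤ) (x : Y)
    (l : List A) :
    kos e (f x l) = sg (e * (d - l.length)) • f (AInf.kos e x) (l.map (AInf.kos e)) := by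
  induction x using gr_induction with
  | h0 =>
    have : ∀ L, f 0 L = 0 := fun L =>
      map_zero (AddMonoidHom.mk' (fun x => f x L) fun a b => h.fst.add a b L)
    simp [this]
  | hg j x hx =>
    have h2 := map_sg (AddMonoidHom.mk' (fun x => f x (l.map (AInf.kos e)))
      fun a b => h.fst.add a b _) (sg (e * j)) x
    simp only [AddMonoidHom.mk'_apply] at h2
    rw [(h.mAdd x).kos (h.deg j x hx), kos_of_mem e hx, h2, smul_smul, ← Int.negOnePow_add]
    congr 2; ring
  | ha x y hx hy => simp only [h.fst.add, map_add, hx, hy, smul_add]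

theorem IsAlgFamily.pull {c : ℤ} {φ : List A → B} (hφ : IsAlgFamily S 1 φ) {C : Type*}
    [AddCommGroup C] [Module S C] [Module Sᵐᵒᵖ C] [ZGraded C] {F : List B → C}
    (hF : IsAlgFamily S c F) : IsAlgFamily S c (AInf.pull φ F) where
  nil := by rw [pull_nil, hF.nil]
  slot := slot_pull hφ.slot hφ.left hF.slot
  left s a l := by
    simp only [pull_cons, hφ.left, hF.left]
    let f := DistribSMul.toAddMonoidHom C s
    rw [show ∀ x : C, s • x = f x from fun _ => rfl, map_cuts]
    simp only [map_pull]
    rfl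
  deg := hφ.deg.pull hF.deg

theorem IsModFamily.barPull {d : ℤ} {φ : List A → B} (hφ : IsAlgFamily S 1 φ)
    {f : Y → List B → N} (hf : IsModFamily S d f) :
    IsModFamily S d fun x l => AInf.pull φ (f x) l where
  fst := hf.fst.pull hφ.left
  slot x := slot_pull hφ.slot hφ.left (hf.slot x)
  deg j x hx := hφ.deg.pull (hf.deg j x hx)

theorem IsModFamily.barComp {d e : ℤ} {g : Z → List A → N} {f : Y → List A → Z}
    (hg : IsModFamily S e g) (hf : IsModFamily S d f) :
    IsModFamily S (d + e) fun x l => AInf.cuts l fun p q => g (f x p) q where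
  fst := hg.fst.comp hf.fst
  slot x p := by
    simp only [cuts_append]
    exact (SlotLinear.cuts p fun u v => hg.slot (f x u) v).sum (hg.fst.comp (hf.slot x p))
  deg j x hx l js hl := by
    refine cuts_mem _ fun p q hpq => ?_
    subst hpq
    obtain ⟨j₁, j₂, rfl, h₁, h₂⟩ := forall₂_split hl
    refine gr_cast (hg.deg _ _ (hf.deg j x hx p j₁ h₁) q j₂ h₂) ?_
    simp; ring

theorem IsModFamily.add {d : ℤ} {f g : Y → List A → N} (hf : IsModFamily S d f)
    (hg : IsModFamily S d g) : IsModFamily S d fun x l => f x l + g x l where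
  fst := hf.fst.sum hg.fst
  slot x p := (hf.slot x p).sum (hg.slot x p)
  deg j x hx l js hl := add_mem (hf.deg j x hx l js hl) (hg.deg j x hx l js hl)

theorem IsModFamily.neg {d : ℤ} {f : Y → List A → N} (hf : IsModFamily S d f) :
    IsModFamily S d fun x l => -f x l where
  fst := hf.fst.neg
  slot x p := (hf.slot x p).neg
  deg j x hx l js hl := neg_mem (hf.deg j x hx l js hl)

theorem IsModFamily.zero {d : ℤ} : IsModFamily S d fun (_ : Y) (_ : List A) => (0 : N) where
  fst := SlotLinear.zero
  slot _ _ := SlotLinear.zero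
  deg _ _ _ _ _ _ := zero_mem _

/-- The involution `twM` undone. -/
theorem eq_twM {f g : Y → List A → N} (h : ∀ x l, f x l = g (AInf.kos l.length x) (theta l)) :
    f = AInf.twM g := funext fun x => funext fun l => h x l

theorem twM_eq_of {f g : Y → List A → N}
    (h : ∀ x l, f x l = g (AInf.kos l.length x) (theta l)) (x : Y) (l : List A) :
    AInf.twM f x l = g x l := by
  rw [AInf.twM, h, theta_theta, theta_length, kos_kos, kos_congr (b := 0) (by simp), kos_zero]

theorem IsModFamily.comp {d e : ℤ} {g : Z → List A → N} {f : Y → List A → Z}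
    (hg : IsModFamily S e g) (hf : IsModFamily S d f) :
    IsModFamily S (d + e) (modComp d g f) := by
  have e := eq_twM (f := modComp d g f)
    (g := fun y L => AInf.cuts L fun p q => AInf.twM g (AInf.twM f y p) q)
    fun x l => modComp_eq hf.kos hg.fst.add x l
  exact e ▸ (hg.twM.barComp hf.twM).twM

theorem IsModFamily.restrict {d : ℤ} {φ : List A → B} (hφ : IsAlgFamily S 1 φ)
    {f : Y → List B → N} (hf : IsModFamily S d f) : IsModFamily S d (modRestrict φ f) := by
  have e := eq_twM (f := modRestrict φ f)
    (g := fun y L => AInf.pull (AInf.twA φ) (AInf.twM f y) L)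
    fun x l => modRestrict_eq hf.mAdd hφ.mAdd hφ.deg x l
  exact e ▸ (hf.twM.barPull hφ.twA).twM

theorem IsAlgFamily.comp {c : ℤ} {φ : List A → B} (hφ : IsAlgFamily S 1 φ) {C : Type*}
    [AddCommGroup C] [Module S C] [Module Sᵐᵒᵖ C] [ZGraded C] {F : List B → C}
    (hF : IsAlgFamily S c F) [IsGradedRight S C] [IsGradedLeft S C] :
    IsAlgFamily S c (algComp F φ) := by
  rw [show algComp F φ = AInf.twA (AInf.pull (AInf.twA φ) (AInf.twA F)) from
    funext fun l => algComp_eq hF.mAdd hφ.mAdd hφ.deg l]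
  exact (hφ.twA.pull hF.twA).twA

end Closure

/-! ### Identities between the operations -/

section Identities

variable {S : Type*} [Ring S]
variable {A B K M N L : Type*} [AddCommGroup A] [Module S A] [Module Sᵐᵒᵖ A] [ZGraded A]
  [AddCommGroup B] [Module S B] [Module Sᵐᵒᵖ B] [ZGraded B]
  [AddCommGroup K] [Module Sᵐᵒᵖ K] [ZGraded K]
  [AddCommGroup M] [Module Sᵐᵒᵖ M] [ZGraded M] [AddCommGroup N] [Module Sᵐᵒᵖ N] [ZGraded N]
  [AddCommGroup L] [Module Sᵐᵒᵖ L] [ZGraded L]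

/-- The identity family: the identity in its first component and `0` in the others. -/
def idMod {M A : Type*} [AddCommGroup M] (x : M) : List A → M
  | [] => x
  | _ :: _ => 0

/-- The identity family of an algebra. -/
def idAlg {A : Type*} [AddCommGroup A] : List A → A
  | [a] => a
  | _ => 0

theorem cuts_last {V : Type*} [AddCommGroup V] (l : List A) (G : List A → List A → V)
    (h : ∀ p q, q ≠ [] → G p q = 0) : cuts l G = G l [] := by
  induction l generalizing G with
  | nil => rfl
  | cons a l ih =>
    rw [cuts, h _ _ (by simp), ih _ fun p q hq => h _ _ hq, zero_add]

theorem cuts_first {V : Type*} [AddCommGroup V] (l : List A) (G : List A → List A → V)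
    (h : ∀ p q, p ≠ [] → G p q = 0) : cuts l G = G [] l := by
  cases l with
  | nil => rfl
  | cons a l =>
    rw [cuts, cuts_congr (G' := fun _ _ => 0) fun p q _ => h _ _ (by simp), cuts_zero, add_zero]

theorem cuts_map {V : Type*} [AddCommGroup V] (φ : A → B) (l : List A)
    (G : List B → List B → V) :
    cuts (l.map φ) G = cuts l fun p q => G (p.map φ) (q.map φ) := by
  induction l generalizing G with
  | nil => rfl
  | cons a l ih => simp only [List.map_cons, cuts, ih, List.map_nil]

theorem IsModFamily.map_zero {d : ℤ} {f : M → List A → N} (h : IsModFamily S d f) (l : List A) :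
    f 0 l = 0 :=
  _root_.map_zero (AddMonoidHom.mk' (fun x => f x l) fun a b => h.fst.add a b l)

theorem isModFamily_id : IsModFamily S 0 (idMod : M → List A → M) where
  fst := {
    add := fun x y l => by cases l <;> simp [idMod]
    last := fun s x => rfl
    bal := fun s x a l => rfl }
  slot x p := by
    have : ∀ a q, idMod x (p ++ a :: q) = 0 := fun a q => by cases p <;> rfl
    simp only [this]
    exact SlotLinear.zero
  deg j x hx l js hl := by
    cases hl with
    | nil => exact gr_cast hx (by simp)
    | cons _ _ => exact zero_mem _

theorem modComp_id_left (d : ℤ) (f : M → List A → N) : modComp d idMod f = f := by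
  funext x l
  rw [modComp, cuts_last]
  · simp [idMod]
  · intro p q hq
    cases q with
    | nil => exact absurd rfl hq
    | cons a q => simp [idMod]

theorem modComp_id_right {d : ℤ} {f : M → List A → N} (hf : IsModFamily S d f) :
    modComp 0 f idMod = f := by
  funext x l
  rw [modComp, cuts_first]
  · simp only [idMod]
    rw [sg_congr (b := 0) ⟨l.length, by simp; ring⟩, sg, Int.negOnePow_zero, one_smul]
  · intro p q hp
    cases p with
    | nil => exact absurd rfl hp
    | cons a p => simp [idMod, hf.map_zero]

theorem modDiff_id (m : List A → A) (d : ℤ) : modDiff m d (idMod : M → List A → M) = 0 := by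
  funext x l
  rw [modDiff, Pi.zero_apply, Pi.zero_apply]
  refine (cuts_congr (G' := fun _ _ => 0) fun p y _ => ?_).trans (cuts_zero l)
  refine (cuts_congr (G' := fun _ _ => 0) fun c q _ => ?_).trans (cuts_zero y)
  have : ∀ z a, idMod z (p.map (kos (2 - (c.length : ℤ))) ++ a :: q) = (0 : M) := fun z a => by
    cases p <;> rfl
  simp only [this, smul_zero, ite_self]

theorem modRestrict_id (φ : List A → B) : modRestrict φ (idMod : M → List B → M) = idMod := by
  funext x l
  cases l with
  | nil => simp [modRestrict, blocksSum_nil, blockSign, degSum, tens, idMod, kos_zero]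
  | cons a l =>
    rw [modRestrict, blocksSum_cons]
    simp only [tens, idMod, smul_zero, blocksSum_zero, cuts_zero]

theorem modComp_assoc {e dg : ℤ} (df : ℤ) {h : N → List A → L} {g : M → List A → N}
    {f : K → List A → M} (hh : IsModFamily S e h) :
    modComp df (modComp dg h g) f = modComp (df + dg) h (modComp df g f) := by
  funext x l
  simp only [modComp]
  have hadd : ∀ (z : List A → List A → N) (P v : List A),
      h (cuts P z) v = cuts P fun p u => h (z p u) v := fun z P v =>
    map_cuts (AddMonoidHom.mk' (fun x => h x v) fun a b => hh.fst.add a b v) P z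
  have hsg : ∀ (u : ℤˣ) z v, h (u • z) v = u • h z v := fun u z v =>
    map_sg (AddMonoidHom.mk' (fun x => h x v) fun a b => hh.fst.add a b v) u z
  simp only [hadd, hsg, ← cuts_smul, smul_smul, ← Int.negOnePow_add]
  let K : List A → List A → List A → L := fun p u v =>
    sg ((df + p.length) * (u.length + v.length) + (dg + u.length) * v.length)
      • h (g (f x p) u) v
  calc _ = cuts l fun p y => cuts y fun u v => K p u v := by
        refine cuts_congr fun p y _ => cuts_congr fun u v huv => ?_
        subst huv
        refine congrArg (· • h (g (f x p) u) v) (sg_congr ?_)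
        simp only [List.length_append]
        exact ⟨u.length + 2 * v.length, by push_cast; ring⟩
    _ = cuts l fun P v => cuts P fun p u => K p u v := cuts_assoc l K
    _ = _ := by
        refine cuts_congr fun P v _ => cuts_congr fun p u hpu => ?_
        subst hpu
        refine congrArg (· • h (g (f x p) u) v) (sg_congr ?_)
        simp only [List.length_append]
        exact ⟨-u.length - v.length, by push_cast; ring⟩

theorem modComp_add_left (d : ℤ) (g g' : M → List A → N) (f : K → List A → M) :
    modComp d (g + g') f = modComp d g f + modComp d g' f := by
  funext x l
  simp only [modComp, Pi.add_apply, smul_add, cuts_add]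

theorem modComp_neg_left (d : ℤ) (g : M → List A → N) (f : K → List A → M) :
    modComp d (-g) f = -modComp d g f := by
  rw [eq_neg_iff_add_eq_zero, ← modComp_add_left]
  funext x l
  simp [modComp, cuts_zero]

theorem modComp_add_right (d : ℤ) {e : ℤ} {g : M → List A → N} (hg : IsModFamily S e g)
    (f f' : K → List A → M) : modComp d g (f + f') = modComp d g f + modComp d g f' := by
  funext x l
  simp only [modComp, Pi.add_apply, hg.fst.add, smul_add, cuts_add]

theorem modComp_neg_right (d : ℤ) {e : ℤ} {g : M → List A → N} (hg : IsModFamily S e g)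
    (f : K → List A → M) : modComp d g (-f) = -modComp d g f := by
  rw [eq_neg_iff_add_eq_zero, ← modComp_add_right d hg]
  funext x l
  simp [modComp, hg.map_zero, cuts_zero]

theorem modDiff_add (m : List A → A) (d : ℤ) (f g : M → List A → N) :
    modDiff m d (f + g) = modDiff m d f + modDiff m d g := by
  funext x l
  simp only [modDiff, Pi.add_apply, ← cuts_add, smul_add]
  refine cuts_congr fun p y _ => cuts_congr fun c q _ => ?_
  split_ifs <;> simp

theorem modDiff_neg (m : List A → A) (d : ℤ) (f : M → List A → N) :
    modDiff m d (-f) = -modDiff m d f := by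
  rw [eq_neg_iff_add_eq_zero, ← modDiff_add]
  funext x l
  simp [modDiff, cuts_zero]

theorem modRestrict_add (φ : List A → B) (f g : M → List B → N) :
    modRestrict φ (f + g) = modRestrict φ f + modRestrict φ g := by
  funext x l
  simp only [modRestrict, Pi.add_apply, smul_add, blocksSum_add]

theorem modRestrict_neg (φ : List A → B) (f : M → List B → N) :
    modRestrict φ (-f) = -modRestrict φ f := by
  rw [eq_neg_iff_add_eq_zero, ← modRestrict_add]
  funext x l
  simp [modRestrict, blocksSum_zero]

variable [IsGradedRight S A] [IsGradedLeft S A] [IsGradedRight S B] [IsGradedLeft S B]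
  [IsGradedRight S K] [IsGradedRight S M] [IsGradedRight S N]

theorem modDiff_add_var {d : ℤ} {f : M → List A → N} (hf : IsModFamily S d f)
    (m : List A → A) (x y : M) (l : List A) :
    modDiff m d f (x + y) l = modDiff m d f x l + modDiff m d f y l := by
  simp only [modDiff, ← cuts_add]
  refine cuts_congr fun p y _ => cuts_congr fun c q _ => ?_
  split_ifs
  · simp
  · rw [map_add, hf.fst.add, smul_add]

theorem MAdd.codiff {V : Type*} [AddCommGroup V] {F : List A → V} (hF : MAdd F)
    {b : List A → A} (hb : MAdd b) : MAdd (AInf.codiff b F) := by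
  intro p q x y
  induction p generalizing F with
  | nil =>
    have h1 : ∀ u v, F (b ((x + y) :: u) :: v) = F (b (x :: u) :: v) + F (b (y :: u) :: v) :=
      fun u v => by rw [show b ((x + y) :: u) = _ from hb [] u x y]; exact hF [] v _ _
    have h2 : ∀ v, F (eb (x + y) :: v) = F (eb x :: v) + F (eb y :: v) :=
      fun v => by rw [map_add]; exact hF [] v _ _
    simp only [List.nil_append, AInf.codiff, h1, h2, cuts_add, codiff_add]
    abel
  | cons c p ih =>
    have h1 : ∀ u v, F (b (c :: (p ++ (x + y) :: u)) :: v)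
        = F (b (c :: (p ++ x :: u)) :: v) + F (b (c :: (p ++ y :: u)) :: v) :=
      fun u v => by
        rw [show b (c :: (p ++ (x + y) :: u)) = _ from hb (c :: p) u x y]; exact hF [] v _ _
    have h2 : ∀ u v, F (b (c :: u) :: (v ++ (x + y) :: q))
        = F (b (c :: u) :: (v ++ x :: q)) + F (b (c :: u) :: (v ++ y :: q)) :=
      fun u v => hF (b (c :: u) :: v) q x y
    simp only [List.cons_append, AInf.codiff, cuts_append, h1, h2, cuts_add,
      ih (hF.cons (eb c))]
    abel

theorem MAdd.theta {V : Type*} [AddCommGroup V] {F : List A → V} (hF : MAdd F) :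
    MAdd fun l => F (AInf.theta l) := by
  intro p q x y
  simp only [theta_append, AInf.theta, map_add, List.length_cons]
  exact hF _ _ _ _

theorem modDiff_mAdd {d : ℤ} {f : M → List A → N} (hf : IsModFamily S d f)
    {m : List A → A} (hm : IsAlgFamily S 2 m) (x : M) : MAdd (modDiff m d f x) := by
  intro p q a b
  simp only [modDiff_eq hf.mAdd hf.fst.add hm.mAdd hm.deg]
  have := ((hf.twM.mAdd (eb (kos (p ++ a :: q).length x))).codiff hm.twA.mAdd).theta p q a b
  simp only [List.length_append, List.length_cons] at this ⊢
  rw [this, smul_add]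

theorem modDiff_kos {d : ℤ} {f : M → List A → N} (hf : IsModFamily S d f)
    {m : List A → A} (hm : IsAlgFamily S 2 m) (e : ℤ) (x : M) (l : List A) :
    kos e (modDiff m d f x l)
      = sg (e * (d + 1 - l.length)) • modDiff m d f (kos e x) (l.map (kos e)) := by
  simp only [modDiff, map_cuts, cuts_map, ← cuts_smul]
  refine cuts_congr fun p y hpy => cuts_congr fun c q hcq => ?_
  subst hcq
  subst hpy
  simp only [List.map_eq_nil_iff, List.length_map]
  split_ifs
  · simp
  · have h1 := hm.mAdd.kos hm.deg e c
    rw [map_sg, hf.kos]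
    simp only [List.map_append, List.map_cons, h1]
    rw [(hf.mAdd _).sg, map_kos_map, map_kos_map, kos_kos, kos_kos]
    simp only [smul_smul, ← Int.negOnePow_add, List.length_append, List.length_map,
      List.length_cons, add_comm e]
    congr 1
    apply sg_congr
    push_cast
    exact ⟨0, by ring⟩

theorem twM_eb {d : ℤ} {f : M → List A → N} (hf : IsModFamily S d f) (x : M) (l : List A) :
    twM f (eb x) (l.map eb) = sg d • eb (twM f x l) := by
  have h := hf.twM.kos 1 x l
  have h2 := (hf.twM.mAdd (kos 1 x)).neg_map (kos 1) l []
  simp only [List.append_nil] at h2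
  have h3 : twM f (eb x) (l.map eb) = -twM f (kos 1 x) (l.map eb) := by
    rw [show eb x = -kos 1 x from rfl]
    exact map_neg (AddMonoidHom.mk' (fun x => twM f x (l.map eb))
      fun a b => hf.twM.fst.add a b _) _
  rw [h3, show l.map eb = l.map fun x => -kos 1 x from rfl, h2, eb, AddMonoidHom.neg_apply, h,
    smul_neg, smul_smul, ← Int.negOnePow_add]
  congr 2
  apply sg_congr
  exact ⟨l.length - d, by ring⟩

theorem modDiff_comp {dg df : ℤ} {m : List A → A} (hm : IsAlgFamily S 2 m)
    {g : M → List A → N} (hg : IsModFamily S dg g) {f : K → List A → M}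
    (hf : IsModFamily S df f) :
    modDiff m (df + dg) (modComp df g f)
      = modComp df (modDiff m dg g) f + sg dg • modComp (df + 1) g (modDiff m df f) := by
  funext x l
  have hgf := hg.comp hf
  rw [Pi.add_apply, Pi.add_apply, Pi.smul_apply, Pi.smul_apply,
    modDiff_eq hgf.mAdd hgf.fst.add hm.mAdd hm.deg,
    modComp_eq hf.kos (modDiff_add_var hg m),
    modComp_eq (modDiff_kos hf hm) hg.fst.add]
  have e1 : ∀ y L, twM (modComp df g f) y L = cuts L fun p q => twM g (twM f y p) q :=
    twM_eq_of (f := modComp df g f) (g := fun y L => cuts L fun p q => twM g (twM f y p) q)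
      fun x l => modComp_eq hf.kos hg.fst.add x l
  have e2 : ∀ y L, twM (modDiff m dg g) y L
      = sg (dg + 1) • codiff (twA m) (twM g (eb y)) L :=
    twM_eq_of (f := modDiff m dg g)
      (g := fun y L => sg (dg + 1) • codiff (twA m) (twM g (eb y)) L)
      fun x l => modDiff_eq hg.mAdd hg.fst.add hm.mAdd hm.deg dg x l
  have e3 : ∀ y L, twM (modDiff m df f) y L
      = sg (df + 1) • codiff (twA m) (twM f (eb y)) L :=
    twM_eq_of (f := modDiff m df f)
      (g := fun y L => sg (df + 1) • codiff (twA m) (twM f (eb y)) L)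
      fun x l => modDiff_eq hf.mAdd hf.fst.add hm.mAdd hm.deg df x l
  rw [show twM (modComp df g f) (eb (kos l.length x))
    = fun L => cuts L fun p q => twM g (twM f (eb (kos l.length x)) p) q from
      funext fun L => e1 _ L, codiff_cuts, ← cuts_smul, ← cuts_smul, ← cuts_add]
  refine cuts_congr fun p q _ => ?_
  have hadd : ∀ v, ∃ F : M →+ N, ∀ z, F z = twM g z v := fun v =>
    ⟨AddMonoidHom.mk' (fun z => twM g z v) fun a b => hg.twM.fst.add a b v, fun _ => rfl⟩
  have h1 : codiff (twA m) (fun p' => twM g (twM f (eb (kos l.length x)) p') q) p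
      = twM g (codiff (twA m) (twM f (eb (kos l.length x))) p) q := by
    obtain ⟨F, hF⟩ := hadd q
    simp only [← hF]
    exact (map_codiff F _ _ _).symm
  have h2 : (fun q' => twM g (twM f (eb (kos l.length x)) (p.map eb)) q')
      = fun q' => (DistribSMul.toAddMonoidHom N (sg df))
        (twM g (eb (twM f (kos l.length x) p)) q') := by
    funext q'
    obtain ⟨F, hF⟩ := hadd q'
    rw [twM_eb hf, ← hF, ← hF, map_sg]
    rfl
  have h3 : ∀ (u : ℤˣ) z, twM g (u • z) q = u • twM g z q := fun u z => by
    obtain ⟨F, hF⟩ := hadd q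
    rw [← hF, ← hF, map_sg]
  rw [h1, h2, ← map_codiff, e2, e3, h3, smul_add, smul_smul, DistribSMul.toAddMonoidHom_apply,
    smul_smul, ← Int.negOnePow_add, ← Int.negOnePow_add, add_comm]
  congr 2
  · apply sg_congr
    exact ⟨df, by ring⟩
  · apply sg_congr
    exact ⟨0, by ring⟩

theorem modRestrict_comp {dg df : ℤ} {φ : List A → B} (hφ : IsAlgFamily S 1 φ)
    {g : M → List B → N} (hg : IsModFamily S dg g) {f : K → List B → M}
    (hf : IsModFamily S df f) :
    modRestrict φ (modComp df g f) = modComp df (modRestrict φ g) (modRestrict φ f) := by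
  funext x l
  have hgf := hg.comp hf
  have hRf := hf.restrict hφ
  have hRg := hg.restrict hφ
  rw [modRestrict_eq hgf.mAdd hφ.mAdd hφ.deg, modComp_eq hRf.kos hRg.fst.add]
  have e1 : ∀ y L, twM (modComp df g f) y L = cuts L fun p q => twM g (twM f y p) q :=
    twM_eq_of (f := modComp df g f) (g := fun y L => cuts L fun p q => twM g (twM f y p) q)
      fun x l => modComp_eq hf.kos hg.fst.add x l
  have e2 : ∀ y L, twM (modRestrict φ g) y L = pull (twA φ) (twM g y) L :=
    twM_eq_of (f := modRestrict φ g) (g := fun y L => pull (twA φ) (twM g y) L)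
      fun x l => modRestrict_eq hg.mAdd hφ.mAdd hφ.deg x l
  have e3 : ∀ y L, twM (modRestrict φ f) y L = pull (twA φ) (twM f y) L :=
    twM_eq_of (f := modRestrict φ f) (g := fun y L => pull (twA φ) (twM f y) L)
      fun x l => modRestrict_eq hf.mAdd hφ.mAdd hφ.deg x l
  rw [show twM (modComp df g f) (kos l.length x)
    = fun L => cuts L fun p q => twM g (twM f (kos l.length x) p) q from
      funext fun L => e1 _ L, pull_cuts]
  refine cuts_congr fun p q _ => ?_
  rw [e2, e3]
  let F : M →+ N := AddMonoidHom.mk' (fun z => pull (twA φ) (twM g z) q) fun a b => by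
    rw [← pull_add]
    congr 1
    funext w
    exact hg.twM.fst.add a b w
  exact (map_pull F (twA φ) (twM f (kos l.length x)) p).symm

theorem twA_eb {φ : List A → B} (hφ : IsAlgFamily S 1 φ) (l : List A) :
    twA φ (l.map eb) = eb (twA φ l) := by
  have h := hφ.twA.mAdd.kos hφ.twA.deg 1 l
  have h2 := hφ.twA.mAdd.neg_map (kos 1) l []
  simp only [List.append_nil] at h2
  rw [show l.map eb = l.map fun x => -kos 1 x from rfl, h2, eb, AddMonoidHom.neg_apply, h,
    ← Units.neg_smul, ← Int.negOnePow_succ]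
  congr 1
  apply sg_congr
  exact ⟨l.length - 1, by ring⟩

theorem codiff_twA {φ : List A → B} (hφ : IsAlgFamily S 1 φ) {m : List A → A}
    (hm : IsAlgFamily S 2 m) {m' : List B → B} (hm' : IsAlgFamily S 2 m') :
    (∀ l, algInsert m φ l = algComp m' φ l)
      ↔ ∀ l, codiff (twA m) (twA φ) l = pull (twA φ) (twA m') l := by
  have e : ∀ l, algInsert m φ l = codiff (twA m) (twA φ) (theta l) := fun l =>
    (algInsert_eq hφ.mAdd hm.mAdd hm.deg l).symm
  constructor
  · intro h l
    have := h (theta l)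
    rwa [e, algComp_eq hm'.mAdd hφ.mAdd hφ.deg, theta_theta] at this
  · intro h l
    rw [e, algComp_eq hm'.mAdd hφ.mAdd hφ.deg, h]

theorem modRestrict_diff {d : ℤ} {φ : List A → B} (hφ : IsAlgFamily S 1 φ) {m : List A → A}
    (hm : IsAlgFamily S 2 m) {m' : List B → B} (hm' : IsAlgFamily S 2 m')
    (hc : ∀ l, algInsert m φ l = algComp m' φ l) {f : M → List B → N}
    (hf : IsModFamily S d f) :
    modRestrict φ (modDiff m' d f) = modDiff m d (modRestrict φ f) := by
  funext x l
  have hRf := hf.restrict hφ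
  rw [modRestrict_eq (modDiff_mAdd hf hm') hφ.mAdd hφ.deg,
    modDiff_eq hRf.mAdd hRf.fst.add hm.mAdd hm.deg]
  have e2 : ∀ y, twM (modDiff m' d f) y
      = fun L => (DistribSMul.toAddMonoidHom N (sg (d + 1)))
        (codiff (twA m') (twM f (eb y)) L) := fun y => funext fun L =>
    twM_eq_of (f := modDiff m' d f)
      (g := fun y L => sg (d + 1) • codiff (twA m') (twM f (eb y)) L)
      (fun x l => modDiff_eq hf.mAdd hf.fst.add hm'.mAdd hm'.deg d x l) y L
  have e3 : ∀ y, twM (modRestrict φ f) y = pull (twA φ) (twM f y) := fun y => funext fun L =>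
    twM_eq_of (f := modRestrict φ f) (g := fun y L => pull (twA φ) (twM f y) L)
      (fun x l => modRestrict_eq hf.mAdd hφ.mAdd hφ.deg x l) y L
  rw [e2, e3, ← map_pull, codiff_pull hφ.twA.nil (twA_eb hφ) ((codiff_twA hφ hm hm').1 hc)
    (hf.twM.mAdd _)]
  rfl

theorem algComp_insert {C : Type*} [AddCommGroup C] [Module S C] [Module Sᵐᵒᵖ C] [ZGraded C]
    [IsGradedRight S C] [IsGradedLeft S C] {φ : List A → B} (hφ : IsAlgFamily S 1 φ)
    {ψ : List B → C} (hψ : IsAlgFamily S 1 ψ) {m : List A → A} (hm : IsAlgFamily S 2 m)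
    {m' : List B → B} (hm' : IsAlgFamily S 2 m') {m'' : List C → C} (hm'' : IsAlgFamily S 2 m'')
    (hc : ∀ l, algInsert m φ l = algComp m' φ l)
    (hc' : ∀ l, algInsert m' ψ l = algComp m'' ψ l) :
    ∀ l, algInsert m (algComp ψ φ) l = algComp m'' (algComp ψ φ) l := by
  rw [codiff_twA (hφ.comp hψ) hm hm'']
  have e : twA (algComp ψ φ) = pull (twA φ) (twA ψ) := by
    funext l
    rw [twA, algComp_eq hψ.mAdd hφ.mAdd hφ.deg, theta_theta]
  intro l
  rw [e, codiff_pull hφ.twA.nil (twA_eb hφ) ((codiff_twA hφ hm hm').1 hc) hψ.twA.mAdd,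
    ← pull_pull hm''.twA.mAdd]
  congr 1
  funext l
  exact (codiff_twA hψ hm' hm'').1 hc' l

theorem isAlgFamily_id : IsAlgFamily S 1 (idAlg : List A → A) where
  nil := rfl
  slot p := by
    cases p with
    | nil => exact {
        add := fun x y l => by cases l <;> simp [idAlg]
        last := fun s x => rfl
        bal := fun s x a l => rfl }
    | cons c p =>
      have : ∀ a q, idAlg (c :: p ++ a :: q) = 0 := fun a q => by cases p <;> rfl
      simp only [this]
      exact SlotLinear.zero
  left s a l := by cases l <;> simp [idAlg]
  deg l js hl := by
    cases hl with
    | nil => exact zero_mem _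
    | @cons a j l js ha hl =>
      cases hl with
      | nil => exact gr_cast ha (by simp)
      | cons _ _ => exact zero_mem _

theorem idAlg_insert {m : List A → A} (hm : IsAlgFamily S 2 m) :
    ∀ l, algInsert m idAlg l = algComp m idAlg l := by
  rw [codiff_twA isAlgFamily_id hm hm]
  have e : twA (idAlg : List A → A) = idAlg := by
    funext l
    match l with
    | [] => rfl
    | [a] => exact kos_zero a
    | _ :: _ :: _ => rfl
  have hp : ∀ (F : List A → A), MAdd F → ∀ l, pull idAlg F l = F l := by
    intro F hF l
    induction l generalizing F with
    | nil => exact pull_nil _ _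
    | cons a l ih =>
      rw [pull_cons, cuts_first]
      · exact ih _ (hF.cons a)
      · intro p q hp
        cases p with
        | nil => exact absurd rfl hp
        | cons c p =>
          have : ∀ l', F (idAlg (a :: c :: p) :: l') = 0 := fun l' => hF.zero [] l'
          simp only [this]
          exact blocksSum_zero _
  intro l
  rw [e, hp _ hm.twA.mAdd]
  cases l with
  | nil => exact hm.nil.symm
  | cons a l =>
    rw [codiff, cuts_last, codiff_congr _ (G := fun _ => 0), codiff_zero, add_zero]
    · rfl
    · intro l hl
      cases l with
      | nil => exact absurd rfl hl
      | cons _ _ => rfl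
    · intro p q hq
      cases q with
      | nil => exact absurd rfl hq
      | cons _ _ => rfl

end Identities

/-! ### Algebras, modules and their categories -/


/-- A graded `S`-`S`-bimodule on which `k` acts centrally. -/
structure GradedBimodule (k : Type uk) (S : Type us) [Field k] [Ring S] [Algebra k S] where
  carrier : Type ua
  [addCommGroup : AddCommGroup carrier]
  [leftModule : Module S carrier]
  [rightModule : Module Sᵐᵒᵖ carrier]
  [smulComm : SMulCommClass S Sᵐᵒᵖ carrier]
  [grading : ZGraded carrier]
  [gradedLeft : IsGradedLeft S carrier]
  [gradedRight : IsGradedRight S carrier]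
  central : ∀ (c : k) (x : carrier), algebraMap k S c • x = op (algebraMap k S c) • x

/-- A graded right `S`-module. -/
structure GradedRightModule (S : Type us) [Ring S] where
  carrier : Type w
  [addCommGroup : AddCommGroup carrier]
  [rightModule : Module Sᵐᵒᵖ carrier]
  [grading : ZGraded carrier]
  [gradedRight : IsGradedRight S carrier]

attribute [instance] GradedBimodule.addCommGroup GradedBimodule.leftModule
  GradedBimodule.rightModule GradedBimodule.smulComm GradedBimodule.grading
  GradedBimodule.gradedLeft GradedBimodule.gradedRight GradedRightModule.addCommGroup
  GradedRightModule.rightModule GradedRightModule.grading GradedRightModule.gradedRight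

variable {k : Type uk} {S : Type us} [Field k] [Ring S] [Algebra k S]

/-- An `A_∞`-algebra: a graded `S`-`S`-bimodule with operations `m_n : A^{⊗n} → A`, `n ≥ 1`, of
degrees `2 - n`, which satisfy the Stasheff identities. -/
structure AInfAlg (k : Type uk) (S : Type us) [Field k] [Ring S] [Algebra k S] extends
    GradedBimodule.{uk, us, ua} k S where
  m : List carrier → carrier
  isFamily : IsAlgFamily S 2 m
  stasheff : ∀ l, algInsert m m l = 0

/-- A morphism of `A_∞`-algebras: maps `f_n : A^{⊗n} → B`, `n ≥ 1`, of degrees `1 - n`, with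
`∑ (-1)^{r+st} f_{r+1+t} (id^{⊗r} ⊗ m_s ⊗ id^{⊗t}) = ∑ (-1)^{sgn} m_r (f_{i₁} ⊗ ⋯ ⊗ f_{i_r})`. -/
structure AInfHom (A : AInfAlg.{uk, us, ua} k S) (B : AInfAlg.{uk, us, ub} k S) where
  f : List A.carrier → B.carrier
  isFamily : IsAlgFamily S 1 f
  map_m : ∀ l, algInsert A.m f l = algComp B.m f l

/-- The identity morphism. -/
def AInfHom.id (A : AInfAlg.{uk, us, ua} k S) : AInfHom A A where
  f := idAlg
  isFamily := isAlgFamily_id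
  map_m := idAlg_insert A.isFamily

/-- The composition `g ∘ f`. -/
noncomputable def AInfHom.comp {A : AInfAlg.{uk, us, ua} k S} {B : AInfAlg.{uk, us, ub} k S}
    {C : AInfAlg.{uk, us, uc} k S} (g : AInfHom B C) (f : AInfHom A B) : AInfHom A C where
  f := algComp g.f f.f
  isFamily := f.isFamily.comp g.isFamily
  map_m := algComp_insert f.isFamily g.isFamily A.isFamily B.isFamily C.isFamily f.map_m g.map_m

/-- `f` and `g` are homotopic: there are maps `h_n : A^{⊗n} → B`, `n ≥ 1`, of degrees `-n`, with
`f_n - g_n = H(h)_n + H_{f,g}(h)_n`. -/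
def AInfHom.Homotopic {A : AInfAlg.{uk, us, ua} k S} {B : AInfAlg.{uk, us, ub} k S}
    (f g : AInfHom A B) : Prop :=
  ∃ h : List A.carrier → B.carrier, IsAlgFamily S 0 h ∧
    ∀ l, f.f l - g.f l = algInsert A.m h l + algHomotopySum B.m f.f g.f h l

/-- `f` is a homotopy equivalence: it has an inverse up to homotopy. -/
def AInfHom.IsHomotopyEquivalence {A : AInfAlg.{uk, us, ua} k S} {B : AInfAlg.{uk, us, ub} k S}
    (f : AInfHom A B) : Prop :=
  ∃ g : AInfHom B A, (g.comp f).Homotopic (AInfHom.id A) ∧ (f.comp g).Homotopic (AInfHom.id B)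

/-- A right `A_∞`-module over `A`: a graded right `S`-module with operations
`m_n : M ⊗ A^{⊗(n-1)} → M`, `n ≥ 1`, of degrees `2 - n`, with `δ(m) + m ∘ m = 0`. Written out, the
`n`-th component of this equation is `∑_{r+s+t=n, r,s≥1} (-1)^{r+st} m_{r+1+t}(id^r ⊗ m_s ⊗ id^t)
+ ∑_{s+t=n, s≥1} (-1)^{st} m_{1+t}(m_s ⊗ id^t) = 0`. -/
structure AInfMod (A : AInfAlg.{uk, us, ua} k S) extends GradedRightModule.{us, w} S where
  m : carrier → List A.carrier → carrier
  isFamily : IsModFamily S 1 m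
  eq_zero : modDiff A.m 1 m + modComp 1 m m = 0

/-- A morphism of right `A_∞`-modules: maps `f_n : M ⊗ A^{⊗(n-1)} → N`, `n ≥ 1`, of degrees
`1 - n`, with `δ(f) + m ∘ f - f ∘ m = 0`. Written out, the `n`-th component of this equation is
`∑_{r+s+t=n, r,s≥1} (-1)^{r+st} f_{r+1+t}(id^r ⊗ m_s ⊗ id^t)
+ ∑_{s+t=n, s≥1} (-1)^{st} f_{1+t}(m_s ⊗ id^t)
- ∑_{r+s=n, r≥1} (-1)^{(r+1)s} m_{1+s}(f_r ⊗ id^s) = 0`, up to a global sign. -/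
@[ext]
structure AInfModHom {A : AInfAlg.{uk, us, ua} k S} (M N : AInfMod.{uk, us, ua, w} A) where
  f : M.carrier → List A.carrier → N.carrier
  isFamily : IsModFamily S 0 f
  eq_zero : modDiff A.m 0 f + modComp 0 N.m f - modComp 1 f M.m = 0

section Category

variable {A : AInfAlg.{uk, us, ua} k S} {B : AInfAlg.{uk, us, ub} k S}

theorem AInfModHom.diff {M N : AInfMod.{uk, us, ua, w} A} (f : AInfModHom M N) :
    modDiff A.m 0 f.f = modComp 1 f.f M.m + -modComp 0 N.m f.f := by
  have := f.eq_zero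
  rw [sub_eq_zero] at this
  rw [← this]; abel

/-- The identity morphism. -/
def AInfModHom.id (M : AInfMod.{uk, us, ua, w} A) : AInfModHom M M where
  f := idMod
  isFamily := isModFamily_id
  eq_zero := by
    rw [modDiff_id, modComp_id_left, modComp_id_right M.isFamily]
    abel

/-- The composition `g ∘ f`. -/
noncomputable def AInfModHom.comp {L M N : AInfMod.{uk, us, ua, w} A} (g : AInfModHom M N)
    (f : AInfModHom L M) : AInfModHom L N where
  f := modComp 0 g.f f.f
  isFamily := g.isFamily.comp f.isFamily
  eq_zero := by
    have h := modDiff_comp A.isFamily g.isFamily f.isFamily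
    simp only [sg, Int.negOnePow_zero, one_smul, zero_add] at h
    rw [h, g.diff, f.diff, modComp_add_left, modComp_neg_left, modComp_add_right 1 g.isFamily,
      modComp_neg_right 1 g.isFamily, modComp_assoc 0 g.isFamily, modComp_assoc 0 N.isFamily,
      modComp_assoc 1 g.isFamily]
    simp only [zero_add, add_zero]
    abel

/-- The category `Mod_∞-A` of right `A_∞`-modules over `A`. -/
noncomputable instance : Category (AInfMod.{uk, us, ua, w} A) where
  Hom M N := AInfModHom M N
  id M := AInfModHom.id M
  comp f g := g.comp f
  id_comp f := AInfModHom.ext (modComp_id_right f.isFamily)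
  comp_id f := AInfModHom.ext (modComp_id_left 0 f.f)
  assoc f g h := AInfModHom.ext (by
    have e := modComp_assoc 0 (dg := 0) (g := g.f) (f := f.f) h.isFamily
    rw [zero_add] at e
    exact e.symm)

/-- Homotopy of morphisms of `A_∞`-modules: there are maps `h_n : M ⊗ A^{⊗(n-1)} → N`, `n ≥ 1`, of
degrees `-n`, with `f - g = δ(h) + m ∘ h + h ∘ m`. Written out, the `n`-th component of the right
hand side is `∑_{r+s=n, r≥1} (-1)^{rs} m_{1+s}(h_r ⊗ id^s) + ∑_{s+t=n, s≥1} (-1)^{st}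
h_{1+t}(m_s ⊗ id^t) + ∑_{r+s+t=n, r,s≥1} (-1)^{r+st} h_{r+1+t}(id^r ⊗ m_s ⊗ id^t)`. -/
def homotopyRel (A : AInfAlg.{uk, us, ua} k S) : HomRel (AInfMod.{uk, us, ua, w} A) :=
  fun M N (f g : AInfModHom M N) => ∃ h : M.carrier → List A.carrier → N.carrier,
    IsModFamily S (-1) h ∧
      f.f - g.f = modDiff A.m (-1) h + modComp (-1) N.m h + modComp 1 h M.m

instance : Congruence (homotopyRel.{uk, us, ua, w} A) where
  equivalence {M N} := {
    refl := fun f => ⟨0, IsModFamily.zero, by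
      have h1 : modDiff A.m (-1) (0 : M.carrier → List A.carrier → N.carrier) = 0 := by
        simpa using modDiff_add A.m (-1) (0 : M.carrier → List A.carrier → N.carrier) 0
      have h2 : modComp (-1) N.m (0 : M.carrier → List A.carrier → N.carrier) = 0 := by
        simpa using modComp_add_right (-1) N.isFamily
          (0 : M.carrier → List A.carrier → N.carrier) 0
      have h3 : modComp 1 (0 : M.carrier → List A.carrier → N.carrier) M.m = 0 := by
        simpa using modComp_add_left 1 (0 : M.carrier → List A.carrier → N.carrier) 0 M.m
      rw [h1, h2, h3, sub_self]; simp⟩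
    symm := fun {f g} ⟨h, hh, e⟩ => ⟨-h, hh.neg, by
      rw [modDiff_neg, modComp_neg_right _ N.isFamily, modComp_neg_left, ← neg_sub, e]; abel⟩
    trans := fun {f g l} ⟨h, hh, e⟩ ⟨h', hh', e'⟩ => ⟨h + h', hh.add hh', by
      rw [modDiff_add, modComp_add_right _ N.isFamily, modComp_add_left,
        ← sub_add_sub_cancel f.f g.f l.f, e, e']; abel⟩ }
  comp_left {L M N} := fun (e : AInfModHom L M) {f g : AInfModHom M N} ⟨h, hh, he⟩ =>
    ⟨modComp 0 h e.f, hh.comp e.isFamily, by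
      change modComp 0 f.f e.f - modComp 0 g.f e.f = _
      have h1 := modDiff_comp A.isFamily hh e.isFamily
      rw [sub_eq_add_neg, ← modComp_neg_left, ← modComp_add_left, ← sub_eq_add_neg, he,
        modComp_add_left, modComp_add_left, modComp_assoc 0 N.isFamily]
      simp only [zero_add] at h1 ⊢
      rw [h1, e.diff, modComp_add_right 1 hh, modComp_neg_right 1 hh, modComp_assoc 0 hh,
        modComp_assoc 1 hh]
      simp only [sg, Int.negOnePow_neg, Int.negOnePow_one, Units.neg_smul, one_smul, zero_add,
        add_zero]
      abel⟩
  comp_right {L M N} := fun {f g : AInfModHom L M} (e : AInfModHom M N) ⟨h, hh, he⟩ =>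
    ⟨modComp (-1) e.f h, by simpa using e.isFamily.comp hh, by
      change modComp 0 e.f f.f - modComp 0 e.f g.f = _
      have h1 := modDiff_comp A.isFamily e.isFamily hh
      rw [sub_eq_add_neg, ← modComp_neg_right 0 e.isFamily, ← modComp_add_right 0 e.isFamily,
        ← sub_eq_add_neg, he, modComp_add_right 0 e.isFamily, modComp_add_right 0 e.isFamily]
      simp only [add_zero, neg_add_cancel] at h1
      rw [h1, e.diff, modComp_add_left, modComp_neg_left, modComp_assoc (-1) e.isFamily,
        modComp_assoc (-1) N.isFamily, modComp_assoc 1 e.isFamily]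
      simp only [sg, Int.negOnePow_zero, one_smul, add_zero, neg_add_cancel]
      rw [add_neg_cancel]
      abel⟩

/-- The homotopy category of `Mod_∞-A`. -/
abbrev HoMod (A : AInfAlg.{uk, us, ua} k S) : Type _ :=
  CategoryTheory.Quotient (homotopyRel.{uk, us, ua, w} A)

/-- The restriction `R_φ(M)` of a module, with operations `R_φ(m)`. -/
noncomputable def AInfMod.restrict (φ : AInfHom A B) (M : AInfMod.{uk, us, ub, w} B) :
    AInfMod.{uk, us, ua, w} A where
  toGradedRightModule := M.toGradedRightModule
  m := modRestrict φ.f M.m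
  isFamily := M.isFamily.restrict φ.isFamily
  eq_zero := by
    rw [← modRestrict_diff φ.isFamily A.isFamily B.isFamily φ.map_m M.isFamily,
      ← modRestrict_comp φ.isFamily M.isFamily M.isFamily, ← modRestrict_add, M.eq_zero]
    simpa using modRestrict_add φ.f (0 : M.carrier → List B.carrier → M.carrier) 0

/-- The restriction of a morphism is a morphism. -/
theorem restrict_hom_eq (φ : AInfHom A B) {M N : AInfMod.{uk, us, ub, w} B}
    (f : AInfModHom M N) :
    modDiff A.m 0 (modRestrict φ.f f.f) + modComp 0 (modRestrict φ.f N.m) (modRestrict φ.f f.f)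
      - modComp 1 (modRestrict φ.f f.f) (modRestrict φ.f M.m) = 0 := by
  rw [← modRestrict_diff φ.isFamily A.isFamily B.isFamily φ.map_m f.isFamily,
    ← modRestrict_comp φ.isFamily N.isFamily f.isFamily,
    ← modRestrict_comp φ.isFamily f.isFamily M.isFamily, ← modRestrict_add, sub_eq_add_neg,
    ← modRestrict_neg, ← modRestrict_add, ← sub_eq_add_neg, f.eq_zero]
  simpa using modRestrict_add φ.f (0 : M.carrier → List B.carrier → N.carrier) 0

/-- The restriction of a morphism. -/
noncomputable def AInfModHom.restrict (φ : AInfHom A B) {M N : AInfMod.{uk, us, ub, w} B}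
    (f : AInfModHom M N) : AInfModHom (M.restrict φ) (N.restrict φ) where
  f := modRestrict φ.f f.f
  isFamily := f.isFamily.restrict φ.isFamily
  eq_zero := restrict_hom_eq φ f

theorem restrict_comp_eq (φ : AInfHom A B) {L M N : AInfMod.{uk, us, ub, w} B}
    (f : AInfModHom L M) (g : AInfModHom M N) :
    modRestrict φ.f (modComp 0 g.f f.f)
      = modComp 0 (modRestrict φ.f g.f) (modRestrict φ.f f.f) :=
  modRestrict_comp φ.isFamily g.isFamily f.isFamily

/-- The restriction functor `R_φ : Mod_∞-B → Mod_∞-A`. -/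
noncomputable def restrict (φ : AInfHom A B) :
    AInfMod.{uk, us, ub, w} B ⥤ AInfMod.{uk, us, ua, w} A where
  obj M := M.restrict φ
  map f := AInfModHom.restrict φ f
  map_id _ := AInfModHom.ext (modRestrict_id φ.f)
  map_comp f g := AInfModHom.ext (restrict_comp_eq φ f g)

theorem restrict_homotopy_eq (φ : AInfHom A B) {M N : AInfMod.{uk, us, ub, w} B}
    (f g : AInfModHom M N) (h : M.carrier → List B.carrier → N.carrier)
    (hh : IsModFamily S (-1) h)
    (e : f.f - g.f = modDiff B.m (-1) h + modComp (-1) N.m h + modComp 1 h M.m) :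
    modRestrict φ.f f.f - modRestrict φ.f g.f
      = modDiff A.m (-1) (modRestrict φ.f h) + modComp (-1) (modRestrict φ.f N.m)
          (modRestrict φ.f h) + modComp 1 (modRestrict φ.f h) (modRestrict φ.f M.m) := by
  rw [← modRestrict_diff φ.isFamily A.isFamily B.isFamily φ.map_m hh,
    ← modRestrict_comp φ.isFamily N.isFamily hh, ← modRestrict_comp φ.isFamily hh M.isFamily,
    ← modRestrict_add, ← modRestrict_add, ← e, sub_eq_add_neg, ← modRestrict_neg,
    ← modRestrict_add, ← sub_eq_add_neg]

/-- Restriction preserves homotopies. -/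
theorem restrict_homotopy (φ : AInfHom A B) {M N : AInfMod.{uk, us, ub, w} B} (f g : M ⟶ N)
    (h : homotopyRel B f g) : homotopyRel A ((restrict φ).map f) ((restrict φ).map g) := by
  obtain ⟨h, hh, e⟩ := h
  exact ⟨modRestrict φ.f h, hh.restrict φ.isFamily, restrict_homotopy_eq φ f g h hh e⟩

/-- The functor between the homotopy categories induced by the restriction functor `R_φ`. -/
noncomputable def hoRestrict (φ : AInfHom A B) :
    HoMod.{uk, us, ub, w} B ⥤ HoMod.{uk, us, ua, w} A :=
  CategoryTheory.Quotient.lift _ (restrict φ ⋙ CategoryTheory.Quotient.functor _)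
    fun _ _ f g h => CategoryTheory.Quotient.sound _ (restrict_homotopy φ f g h)

end Category

end AInf

namespace AInf

/-! ### Homotopies in the bar construction -/

section HomotopyPull

variable {A B V W : Type*} [AddCommGroup A] [AddCommGroup B] [AddCommGroup V] [AddCommGroup W]
  [ZGraded A] [ZGraded B]

/-! Suspension removes the signs. After conjugation by `twA` and `twM`, an operation `m` becomes a
coderivation of the tensor coalgebra, a morphism of algebras becomes a coalgebra map commuting with
the coderivations, and a homotopy `h` from `φ` to `ψ` becomes the coderivation `∑ φ^{⊗r} ⊗ h ⊗
ψ^{⊗t}` relative to this pair of coalgebra maps. Families are encoded by their values on lists, so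
each of these acts by precomposition: `codiff`, `pull`, `homotopyPull`.

For a family `u` of maps out of `M ⊗ B^{⊗n}`, inserting `φ ⊗ ⋯ ⊗ h ⊗ ⋯ ⊗ ψ` in the algebra variables
gives a family `H(u)` (`modHomotopy`) of degree one lower. Two formulas carry the argument.
`modHomotopy_diff` says that `H` is a chain homotopy: `δ(H u) = H(δ u) ± (R_φ u - R_ψ u)`.
`modHomotopy_comp` is a Leibniz rule: `H(v ∘ u) = R_ψ v ∘ H u ± H v ∘ R_φ u`. The first rests on
`homotopyPull_codiff`, where the defining equation of a homotopy, which only concerns the projection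
to cogenerators, is extended to the whole tensor coalgebra. The second is the coderivation property
`homotopyPull_cuts`.

Now let `h` be a homotopy from `f` to `g`. Applied to the operations of a module `M`, where `δ(m) =
-m ∘ m`, the two formulas say exactly that `id - H(m)` is a morphism from `R_f M` to `R_g M`.
Applied to a module morphism `t`, where `δ(t) = t ∘ m - m ∘ t`, they say that `H(t)` is a homotopy
between the two composites of the naturality square. The comparison is therefore natural in the
homotopy category. It is invertible before passing to homotopy classes: `H(m)` has no first
component, so the geometric series `∑ H(m)^i` is finite on each list, and a family inverse to a
morphism is again a morphism.

For homotopy equivalences, restriction is contravariantly functorial: `R_id` and `R_{g ∘ f}` agree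
with the identity and with `R_f R_g`, through isomorphisms whose underlying maps are identities.
Combined with the comparison for `g ∘ f ∼ id` and `f ∘ g ∼ id`, this makes `R_g` a quasi-inverse of
`R_f` on homotopy categories. -/

theorem blocksSum_map (k : A → B) (l : List A) (G : List (List B) → V) :
    blocksSum (l.map k) G = blocksSum l fun bs => G (bs.map (List.map k)) := by
  induction hn : l.length using Nat.strong_induction_on generalizing l G with
  | _ n ih =>
  cases l with
  | nil => simp [blocksSum_nil]
  | cons a l =>
    simp only [List.map_cons, blocksSum_cons, cuts_map]
    refine cuts_congr fun p q hpq => ?_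
    rw [ih q.length (by subst hn; subst hpq; simp) q _ rfl]

theorem pull_congr (φ : List A → B) {F G : List B → V} (h : ∀ l, F l = G l) (l : List A) :
    pull φ F l = pull φ G l := by
  rw [show F = G from funext h]

theorem cuts_sub (l : List A) (G G' : List A → List A → V) :
    (cuts l fun p q => G p q - G' p q) = cuts l G - cuts l G' := by
  simp only [cuts_eq_sum, Finset.sum_sub_distrib]

theorem cuts_neg (l : List A) (G : List A → List A → V) :
    (cuts l fun p q => -G p q) = -cuts l G := by
  simp only [cuts_eq_sum, Finset.sum_neg_distrib]

theorem pull_zero (φ : List A → B) (l : List A) : pull φ (fun _ => (0 : V)) l = 0 :=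
  blocksSum_zero l

theorem eb_eb (x : B) : eb (eb x) = x := by
  simp only [eb, AddMonoidHom.neg_apply, map_neg, neg_neg, kos_kos]
  rw [kos_congr (b := 0) (by decide), kos_zero]

/-- Precomposition with the map of tensor coalgebras `∑ φ^{⊗r} ⊗ h ⊗ ψ^{⊗t}` determined by `h`
of odd degree, which is a coderivation with respect to the coalgebra maps `φ` and `ψ`. -/
noncomputable def homotopyPull {A B V : Type*} [AddCommGroup V] [AddCommGroup B] [ZGraded B]
    (φ h ψ : List A → B) (F : List B → V) (l : List A) : V :=
  cuts l fun p y => cuts y fun x q =>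
    pull φ (fun p' => pull ψ (fun q' => F (p'.map eb ++ h x :: q')) q) p

variable (φ h ψ : List A → B)

theorem homotopyPull_add (F G : List B → V) (l : List A) :
    homotopyPull φ h ψ (fun l' => F l' + G l') l
      = homotopyPull φ h ψ F l + homotopyPull φ h ψ G l := by
  simp only [homotopyPull, pull_add, cuts_add]

theorem homotopyPull_zero (l : List A) : homotopyPull φ h ψ (fun _ => (0 : V)) l = 0 := by
  simp only [homotopyPull, pull_zero, cuts_zero]

theorem map_homotopyPull (f : V →+ W) (F : List B → V) (l : List A) :
    f (homotopyPull φ h ψ F l) = homotopyPull φ h ψ (fun l' => f (F l')) l := by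
  simp only [homotopyPull, map_cuts, map_pull]

variable {φ h ψ}

theorem MAdd.pull_zero_cons {F : List B → V} (hF : MAdd F) (θ : List A → B) (l : List A) :
    pull θ (fun l' => F (0 :: l')) l = 0 := by
  have : ∀ l', F (0 :: l') = 0 := fun l' => hF.zero [] l'
  simp only [this, pull_zero]

/-- Sorts the summands by their first tensor factor: either `h` comes first, or a block of `φ` does,
which picks up the sign `eb` because `h` has to move past it. The block `p` may be empty here, since
`φ [] = 0` kills the extra `φ` term. Summing over all cuts is what makes `codiff_cuts` applicable
later. -/
theorem homotopyPull_eq_cuts (hφ : φ [] = 0) {F : List B → V} (hF : MAdd F) (l : List A) :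
    homotopyPull φ h ψ F l = cuts l fun p q => pull ψ (fun l' => F (h p :: l')) q
      + homotopyPull φ h ψ (fun l' => F (eb (φ p) :: l')) q := by
  -- Here `p` is the part of the list left of `h`. For empty `p` no `φ` precedes `h`; for nonempty
  -- `p` the first block of `φ` is split off.
  have key : ∀ p y, (cuts y fun x q =>
      pull φ (fun p' => pull ψ (fun q' => F (p'.map eb ++ h x :: q')) q) p)
      = (if p = [] then cuts y fun x q => pull ψ (fun l' => F (h x :: l')) q else 0)
        + cuts p fun p₁ p₂ => cuts y fun x q => pull φ (fun p' => pull ψ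
          (fun q' => F (eb (φ p₁) :: (p'.map eb ++ h x :: q'))) q) p₂ := by
    intro p y
    by_cases hp : p = []
    · subst hp
      have : ∀ l', F (0 :: l') = 0 := fun l' => hF.zero [] l'
      simp only [if_true, cuts, pull_nil, hφ, map_zero, this, pull_zero, cuts_zero, add_zero,
        List.map_nil, List.nil_append]
    · rw [if_neg hp, zero_add]
      have : ∀ x q, pull φ (fun p' => pull ψ (fun q' => F (p'.map eb ++ h x :: q')) q) p
          = cuts p fun p₁ p₂ => pull φ (fun p' => pull ψ
            (fun q' => F (eb (φ p₁) :: (p'.map eb ++ h x :: q'))) q) p₂ := by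
        intro x q
        refine pull_eq_cuts hφ ?_ hp
        intro u v a b
        rw [← pull_add]
        refine pull_congr ψ (fun q' => ?_) q
        have := hF (u.map eb) (v.map eb ++ h x :: q') (eb a) (eb b)
        simpa using this
      simp only [this, cuts_eq_sum]
      exact Finset.sum_comm
  rw [homotopyPull]
  simp only [key, cuts_add]
  congr 1
  · rw [cuts_first]
    · simp
    · intro p q hp
      simp [hp]
  · rw [← cuts_assoc]
    rfl

theorem homotopyPull_nil (hh : h [] = 0) {F : List B → V} (hF : MAdd F) :
    homotopyPull φ h ψ F [] = 0 := by
  simpa [homotopyPull, cuts, pull_nil, hh] using hF.zero [] []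

/-- Here the first block is nonempty, so the remaining list is strictly shorter. This is the form
suited to induction on the length. -/
theorem homotopyPull_cons (hφ : φ [] = 0) (hh : h [] = 0) {F : List B → V} (hF : MAdd F) (a : A)
    (l : List A) :
    homotopyPull φ h ψ F (a :: l) = cuts l fun p q => pull ψ (fun l' => F (h (a :: p) :: l')) q
      + homotopyPull φ h ψ (fun l' => F (eb (φ (a :: p)) :: l')) q := by
  have : ∀ l', F (0 :: l') = 0 := fun l' => hF.zero [] l'
  rw [homotopyPull_eq_cuts hφ hF, cuts]
  simp only [hφ, hh, map_zero, this, pull_zero, homotopyPull_zero, zero_add]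

/-- The coderivation property `Δ H = (H ⊗ ψ + φ ⊗ H) Δ` for deconcatenation `Δ`. A cut of the output
falls either to the right of `h`, leaving only `ψ` on the right part, or to its left, leaving only
`φ` on the left part; in the second case `h` has passed the left part, whence `eb`. -/
theorem homotopyPull_cuts (H : List B → List B → V) (l : List A) :
    homotopyPull φ h ψ (fun l' => cuts l' H) l
      = cuts l fun p q => homotopyPull φ h ψ (fun u => pull ψ (fun v => H u v) q) p
        + pull φ (fun u => homotopyPull φ h ψ (fun v => H (u.map eb) v) q) p := by
  simp only [homotopyPull, cuts_append, cuts_map, pull_add, pull_cuts, pull_cuts', cuts_add]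
  rw [add_comm]
  congr 1
  · rw [← cuts_assoc]
    refine cuts_congr fun p y _ => ?_
    rw [← cuts_assoc]
  · have e : ∀ p y, (cuts y fun x q => cuts p fun p₁ p₂ => pull φ (fun u => pull φ (fun v => pull ψ
          (fun w => H (u.map eb) (v.map eb ++ h x :: w)) q) p₂) p₁)
        = cuts p fun p₁ p₂ => cuts y fun x q => pull φ (fun u => pull φ (fun v => pull ψ
          (fun w => H (u.map eb) (v.map eb ++ h x :: w)) q) p₂) p₁ := by
      intro p y
      simp only [cuts_eq_sum]
      exact Finset.sum_comm
    simp only [e]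
    rw [← cuts_assoc]

/-- Both sides are coderivations relative to `φ` and `ψ`, and such a map is determined by its
projection to cogenerators, where the identity is the hypothesis `hc`. The `eb` hypotheses record
parities after suspension: `φ` and `ψ` are even, `h` and `b'` are odd. The proof makes the principle
explicit by induction on the length, separating the first tensor factor of the output from the rest.
-/
theorem homotopyPull_codiff {b : List A → A} {b' : List B → B} (hφ : φ [] = 0) (hψ : ψ [] = 0)
    (hh : h [] = 0) (hφe : ∀ l, φ (l.map eb) = eb (φ l)) (hψe : ∀ l, ψ (l.map eb) = eb (ψ l))
    (hhe : ∀ l, h (l.map eb) = -eb (h l)) (hbe : ∀ l, b' (l.map eb) = -eb (b' l))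
    (hb' : MAdd b') (hb0 : b' [] = 0)
    (hφc : ∀ l, codiff b φ l = pull φ b' l) (hψc : ∀ l, codiff b ψ l = pull ψ b' l)
    (hc : ∀ l, φ l - ψ l = codiff b h l + homotopyPull φ h ψ b' l)
    {F : List B → V} (hF : MAdd F)
    (l : List A) :
    codiff b (homotopyPull φ h ψ F) l + homotopyPull φ h ψ (codiff b' F) l
      = pull φ F l - pull ψ F l := by
  induction hn : l.length using Nat.strong_induction_on generalizing l F with
  | _ n ih =>
  by_cases hl : l = []
  · subst hl
    simp [codiff, pull_nil, homotopyPull_nil hh (hF.codiff hb')]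
  -- With the tail fixed, `F` is an additive function of its first entry; as such it can be moved in
  -- and out of `codiff`, `pull` and `homotopyPull`.
  have add1 : ∀ v, ∃ f : B →+ V, ∀ c, f c = pull ψ (fun w => F (c :: w)) v := fun v =>
    ⟨AddMonoidHom.mk' (fun c => pull ψ (fun w => F (c :: w)) v) fun x y => by
      rw [← pull_add]
      exact pull_congr ψ (fun w => hF [] w x y) v, fun _ => rfl⟩
  have add2 : ∀ v, ∃ f : B →+ V, ∀ c, f c = homotopyPull φ h ψ (fun w => F (eb c :: w)) v :=
    fun v => ⟨AddMonoidHom.mk' (fun c => homotopyPull φ h ψ (fun w => F (eb c :: w)) v)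
      fun x y => by
        rw [← homotopyPull_add]
        congr 1
        funext w
        rw [map_add]
        exact hF [] w _ _, fun _ => rfl⟩
  rw [codiff_congr b (fun l' _ => homotopyPull_eq_cuts hφ hF l'), codiff_cuts,
    homotopyPull_eq_cuts hφ (hF.codiff hb'), pull_eq_cuts hφ hF hl, pull_eq_cuts hψ hF hl]
  simp only [codiff, codiff_add, pull_add, pull_cuts, homotopyPull_add, homotopyPull_cuts, cuts_add,
    eb_eb, hφe, hhe]
  rw [cuts_assoc, cuts_assoc, cuts_assoc]
  -- The differential acts to the right of a leading `h`. The terms before and after applying `ψ`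
  -- cancel: `ψ` commutes with the differentials, and `h` is odd.
  have e1 : ∀ p q, codiff b (fun q' => pull ψ (fun l' => F (-eb (h p) :: l')) q') q
      = -pull ψ (codiff b' fun l' => F (eb (h p) :: l')) q := by
    intro p q
    rw [← codiff_pull hψ hψe hψc (hF.cons _)]
    have : (fun q' => pull ψ (fun l' => F (-eb (h p) :: l')) q')
        = fun q' => (-AddMonoidHom.id V) (pull ψ (fun l' => F (eb (h p) :: l')) q') := by
      funext q'
      obtain ⟨f, hf⟩ := add1 q'
      rw [← hf, ← hf, map_neg]
      rfl
    rw [this, ← map_codiff]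
    rfl
  -- Both the differential and `h` act to the right of a leading `φ p`: the induction hypothesis.
  -- For `p = []` the tail is not shorter, but all terms vanish because `φ [] = 0`.
  have e2 : (cuts l fun p q => codiff b (homotopyPull φ h ψ fun l' => F (φ p :: l')) q
        + homotopyPull φ h ψ (codiff b' fun l' => F (φ p :: l')) q)
      = cuts l fun p q => pull φ (fun l' => F (φ p :: l')) q
        - pull ψ (fun l' => F (φ p :: l')) q := by
    refine cuts_congr fun p q hpq => ?_
    by_cases hp : p = []
    · have : ∀ l', F (0 :: l') = 0 := fun l' => hF.zero [] l'
      subst hp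
      have z : (homotopyPull φ h ψ fun _ => (0 : V)) = fun _ => 0 :=
        funext fun l => homotopyPull_zero _ _ _ _
      have z' : (codiff b' fun _ => (0 : V)) = fun _ => 0 :=
        funext fun l => codiff_zero _ _
      simp only [hφ, this, pull_zero, z, z', codiff_zero, sub_self, add_zero]
    · refine ih q.length ?_ (hF.cons _) q rfl
      subst hn; subst hpq
      have := List.length_pos_iff.2 hp
      simp only [List.length_append]; omega
  -- Both the differential and `h` are absorbed into the first factor, where `hc` turns their sum
  -- into `φ P - ψ P`.
  have e3 : ∀ P v, codiff b (fun p' => pull ψ (fun l' => F (h p' :: l')) v) P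
        + ((cuts P fun p u => pull ψ (fun u' => pull ψ (fun l' => F (b' (h p :: u') :: l')) v) u)
          + cuts P fun p u => homotopyPull φ h ψ
              (fun u' => pull ψ (fun l' => F (b' (eb (φ p) :: u') :: l')) v) u)
      = pull ψ (fun l' => F (φ P :: l')) v - pull ψ (fun l' => F (ψ P :: l')) v := by
    intro P v
    obtain ⟨f, hf⟩ := add1 v
    simp only [← hf]
    rw [← map_sub, hc, map_add, map_codiff, homotopyPull_eq_cuts hφ hb', map_cuts]
    simp only [map_add, map_pull, map_homotopyPull, cuts_add]
  -- The differential is in the first factor and `h` further right. The two terms cancel since `φ`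
  -- commutes with the differentials and `b'` anticommutes with `eb`.
  have e4 : ∀ P v, codiff b (fun p' => homotopyPull φ h ψ (fun l' => F (eb (φ p') :: l')) v) P
        + (cuts P fun p u => pull φ (fun u' => homotopyPull φ h ψ
            (fun l' => F (b' (eb (φ p) :: u'.map eb) :: l')) v) u) = 0 := by
    intro P v
    obtain ⟨f, hf⟩ := add2 v
    have : ∀ p u', homotopyPull φ h ψ (fun l' => F (b' (eb (φ p) :: u'.map eb) :: l')) v
        = -f (b' (φ p :: u')) := by
      intro p u'
      rw [← map_neg, hf, ← eb_eb (b' (eb (φ p) :: u'.map eb))]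
      have := hbe (φ p :: u')
      simp only [List.map_cons] at this
      rw [this, map_neg, eb_eb]
    simp only [this, ← hf]
    rw [← map_codiff, hφc]
    have e : ∀ p u, pull φ (fun u' => -f (b' (φ p :: u'))) u
        = (-f) (pull φ (fun u' => b' (φ p :: u')) u) := fun p u => (map_pull (-f) φ _ u).symm
    simp only [e, ← map_cuts]
    by_cases hP : P = []
    · subst hP
      have : b' (0 :: []) = 0 := hb'.zero [] []
      simp [cuts, pull_nil, hφ, this, hb0]
    · rw [← pull_eq_cuts hφ hb' hP, AddMonoidHom.neg_apply, add_neg_cancel]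
  -- Adding everything, the mixed terms with `φ` in the first factor and `ψ` afterwards cancel
  -- between `e2` and `e3`, which leaves `pull φ F - pull ψ F`.
  have e5 := congrArg₂ (· + ·) (cuts_congr (l := l) fun P v _ => e3 P v)
    (cuts_congr (l := l) fun P v _ => e4 P v)
  simp only [cuts_add, cuts_sub] at e2 e5
  rw [cuts_zero] at e5
  have e6 := (cuts_congr (l := l) fun p q _ => e1 p q).trans (cuts_neg l _)
  have e7 := congrArg₂ (· + ·) (congrArg₂ (· + ·) e2 e5) e6
  rw [← sub_eq_zero] at e7 ⊢
  rw [← e7]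
  abel

end HomotopyPull

/-! ### The signs in the definition of a homotopy, explained by suspension -/

section HomotopySum

variable {A B V : Type*} [AddCommGroup A] [ZGraded A] [AddCommGroup B] [ZGraded B]
  [AddCommGroup V]

/-- The variant of `blocks_term` for the factors to the left of `h`. Here `w` counts the inputs and
`n` the outputs of the maps standing to the right of these blocks. Those maps are one `h` and some
`ψ`, of total degree `n - w - 1`, so the parity condition says that `e` may serve as that degree in
Koszul signs. -/
theorem left_blocks_term {F : List B → V} (hF : MAdd F) {φ : List A → B} (hφ : MAdd φ)
    (hd : HasDeg 1 φ) {n w e : ℤ} (he : Even (e - (n + w + 1))) (bs : List (List A)) :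
    F ((theta ((((Theta bs).map (List.map (kos w))).map (twA φ)).map eb)).map (kos n))
      = sg (bs.length + blockSign bs + (n + 1) * degSum bs) • F (tens φ e bs) := by
  induction bs generalizing F with
  | nil => simp [Theta, theta, blockSign, tens, degSum]
  | cons b bs ih =>
    simp only [Theta, List.map_cons, theta, List.length_map, Theta_length, tens]
    rw [ih (hF.cons _)]
    have e1 : kos n (kos bs.length (eb (twA φ (((theta b).map (kos bs.flatten.length)).map
        (kos w)))))
        = sg (1 + (n + bs.length + 1) * (1 - b.length)) • φ (b.map (kos (degSum bs + e))) := by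
      simp only [eb, AddMonoidHom.neg_apply, map_neg, kos_kos]
      rw [twA, theta_map_kos, theta_map_kos, theta_theta, hφ.kos hd, map_kos_map, map_kos_map,
        ← Units.neg_smul, ← Int.negOnePow_succ]
      · rw [map_kos_congr (a := n + (bs.length + 1) + (w + bs.flatten.length)) (b := degSum bs + e)]
        · congr 1
          apply sg_congr
          simp only [List.length_map]
          exact ⟨0, by ring⟩
        · obtain ⟨c, hc⟩ := he
          rw [degSum_eq, eq_add_of_sub_eq hc]
          exact ⟨bs.flatten.length - c, by ring⟩
    have h2 := hF.sg [] (tens φ e bs) (sg (1 + (n + bs.length + 1) * (1 - b.length)))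
      (φ (b.map (kos (degSum bs + e))))
    simp only [List.nil_append] at h2
    rw [e1, h2, smul_smul, ← Int.negOnePow_add]
    congr 1
    apply sg_congr
    simp only [List.length_cons, blockSign, degSum, List.map_cons, List.sum_cons]
    push_cast
    exact ⟨bs.length * (1 - (b.length : ℤ)), by ring⟩

/-- The sign prescribed in a homotopy is the one produced by suspending every factor, so the sum
becomes `homotopyPull` with no sign other than `eb`. -/
theorem algHomotopySum_eq {m : List B → B} (hm : MAdd m) {f g h : List A → B}
    (hf : MAdd f) (hfd : HasDeg 1 f) (hg : MAdd g) (hgd : HasDeg 1 g) (hh : MAdd h)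
    (hhd : HasDeg 0 h) (hh0 : h [] = 0) (l : List A) :
    algHomotopySum m f g h l
      = homotopyPull (twA f) (twA h) (twA g) (twA m) (theta l) := by
  rw [homotopyPull, cuts_theta, algHomotopySum]
  refine cuts_congr fun p y _ => ?_
  rw [cuts_theta]
  refine cuts_congr fun x q hxq => ?_
  simp only [pull]
  rw [blocksSum_map, blocksSum_theta]
  -- `homotopyPull` also allows an empty argument of `h`; those summands vanish because `h [] = 0`.
  split_ifs with hx
  · subst hx
    have z : ∀ l l', twA m (l ++ 0 :: l') = 0 := fun l l' => hm.theta.zero l l'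
    simp only [theta, List.map_nil, show twA h [] = 0 from hh0, z, blocksSum_zero]
  · refine blocksSum_congr fun bs hbs _ => ?_
    rw [blocksSum_theta]
    refine blocksSum_congr fun cs hcs _ => ?_
    rw [twA, theta_append]
    simp only [theta, List.length_cons, List.length_map, Theta_length]
    have e1 : kos cs.length (twA h ((theta x).map (kos q.length)))
        = sg (cs.length * x.length) • h (x.map (kos (degSum cs))) := by
      rw [twA, theta_map_kos, theta_theta, hh.kos hhd, map_kos_map,
        map_kos_congr (a := cs.length + q.length) (b := degSum cs)]
      · congr 1
        apply sg_congr
        simp only [List.length_map]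
        exact ⟨-(cs.length * x.length), by ring⟩
      · rw [degSum_eq, hcs]
        exact ⟨q.length, by ring⟩
    have h1 : MAdd fun L => m (tens f (-x.length + degSum cs) bs
        ++ h (x.map (kos (degSum cs))) :: L) := fun u v a b => by
      have := hm (tens f (-x.length + degSum cs) bs ++ h (x.map (kos (degSum cs))) :: u) v a b
      simpa using this
    have h2 : MAdd fun L => m (L ++ h (x.map (kos (degSum cs))) ::
        theta ((Theta cs).map (twA g))) := fun u v a b => by
      have := hm u (v ++ h (x.map (kos (degSum cs))) :: theta ((Theta cs).map (twA g))) a b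
      simpa using this
    have h3 := blocks_term h1 hg hgd cs
    -- To the right of the left blocks stand `h` and the blocks `cs`: `cs.length + 1` outputs,
    -- `y.length` inputs, and degree `-x.length + degSum cs`.
    have h4 := left_blocks_term h2 hf hfd (n := ((cs.length + 1 : ℕ) : ℤ)) (w := y.length)
      (e := -x.length + degSum cs) (by
        subst hxq
        rw [degSum_eq, hcs]
        simp only [List.length_append]
        exact ⟨-x.length - q.length - 1, by push_cast; ring⟩) bs
    rw [e1, hm.sg, h4, h3, smul_smul, smul_smul, ← Int.negOnePow_add, ← Int.negOnePow_add]
    congr 1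
    apply sg_congr
    have h5 := degSum_eq bs
    rw [hbs] at h5
    rw [h5]
    push_cast
    exact ⟨-blockSign bs - blockSign cs - bs.length + (cs.length + 1) * p.length,
      by ring⟩

end HomotopySum
-- Linearity and degree of the families produced by a homotopy
section HomotopyClosure

variable {S : Type*} [Ring S]
variable {Y A B N : Type*} [AddCommGroup Y] [Module Sᵐᵒᵖ Y]
  [AddCommGroup A] [Module S A] [Module Sᵐᵒᵖ A] [AddCommGroup B] [Module S B] [Module Sᵐᵒᵖ B]
  [AddCommGroup N] [Module Sᵐᵒᵖ N] [ZGraded Y] [ZGraded A] [ZGraded B] [ZGraded N]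
  [IsGradedRight S Y] [IsGradedRight S A] [IsGradedLeft S A] [IsGradedRight S B] [IsGradedLeft S B]

theorem op_eb (s : S) (x : Y) : eb (op s • x) = op s • eb x := by
  simp only [eb, AddMonoidHom.neg_apply, op_kos, smul_neg]

theorem smul_eb (s : S) (x : A) : eb (s • x) = s • eb x := by
  simp only [eb, AddMonoidHom.neg_apply, smul_kos, smul_neg]

theorem eb_mem {j : ℤ} {x : Y} (hx : x ∈ gr j) : eb x ∈ gr j := neg_mem (kos_mem 1 hx)

theorem SlotLinear.comp_eb {f : Y → List A → N} (hf : SlotLinear S f) :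
    SlotLinear S fun y l => f (eb y) l where
  add x y l := by rw [map_add, hf.add]
  last s x := by rw [op_eb, hf.last]
  bal s x a l := by rw [op_eb, hf.bal]

variable {φ h ψ : List A → B} {c d : ℤ}

/-- The factor next to the variable `y` is a value of `h` or of `φ`, both left `S`-linear in their
first entry. On the empty list everything is zero, because `h` needs at least one argument. -/
theorem SlotLinear.homotopyPull (hφ : IsAlgFamily S c φ) (hh : IsAlgFamily S d h)
    {f : Y → List B → N} (hf : SlotLinear S f) (hfm : ∀ y, MAdd (f y)) :
    SlotLinear S fun y l => AInf.homotopyPull φ h ψ (f y) l where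
  add x y l := by
    rw [← homotopyPull_add, show f (x + y) = fun l' => f x l' + f y l' from funext (hf.add x y)]
  last s x := by simp only [homotopyPull_nil hh.nil (hfm _), smul_zero]
  bal s x a l := by
    simp only [homotopyPull_cons hφ.nil hh.nil (hfm _), hf.bal, hφ.left, hh.left, smul_eb]

theorem slot_homotopyPull (hφ : IsAlgFamily S c φ) (hh : IsAlgFamily S d h)
    (hψ : IsAlgFamily S c ψ) {F : List B → N}
    (hF : ∀ p, SlotLinear S fun a q => F (p ++ a :: q)) (p : List A) :
    SlotLinear S fun a q => homotopyPull φ h ψ F (p ++ a :: q) := by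
  induction hn : p.length using Nat.strong_induction_on generalizing p F with
  | _ n ih =>
  have hm := MAdd_of_slot hF
  have z₁ : SlotLinear S fun z v => pull ψ (fun l' => F (z :: l')) v := (hF []).pull hψ.left
  have z₂ : SlotLinear S fun z v => homotopyPull φ h ψ (fun l' => F (eb z :: l')) v :=
    ((hF []).homotopyPull hφ hh fun y => hm.cons y).comp_eb
  -- The summands in which the distinguished entry `a` lies in the first block. Those in which it
  -- lies in a later block are covered by the induction hypothesis and by `slot_pull`.
  have z : ∀ p, SlotLinear S fun a q => (cuts q fun u v =>
      pull ψ (fun l' => F (h (p ++ a :: u) :: l')) v)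
        + cuts q fun u v => homotopyPull φ h ψ (fun l' => F (eb (φ (p ++ a :: u)) :: l')) v :=
    fun p => (z₁.comp (hh.slot p)).sum (z₂.comp (hφ.slot p))
  have hF' : ∀ b p, SlotLinear S fun a q => F (b :: (p ++ a :: q)) := fun b p => hF (b :: p)
  cases p with
  | nil =>
    simp only [List.nil_append, homotopyPull_cons hφ.nil hh.nil hm, cuts_add]
    exact z []
  | cons c p =>
    simp only [List.cons_append, homotopyPull_cons hφ.nil hh.nil hm, cuts_append, cuts_add]
    have : ∀ i, SlotLinear S fun a q =>
        pull ψ (fun l' => F (h (c :: p.take i) :: l')) (p.drop i ++ a :: q)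
          + homotopyPull φ h ψ (fun l' => F (eb (φ (c :: p.take i)) :: l'))
              (p.drop i ++ a :: q) := fun i =>
      (slot_pull hψ.slot hψ.left (hF' _) _).sum
        (ih (p.drop i).length (by subst hn; simp) (hF' _) _ rfl)
    have e : SlotLinear S fun a q => (cuts p fun u v =>
        pull ψ (fun l' => F (h (c :: u) :: l')) (v ++ a :: q))
          + cuts p fun u v => homotopyPull φ h ψ (fun l' => F (eb (φ (c :: u)) :: l'))
              (v ++ a :: q) := by
      simp only [cuts_eq_sum p, ← Finset.sum_add_distrib]
      exact {
        add := fun x y l => by simp only [(this _).add, Finset.sum_add_distrib]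
        last := fun s x => by simp only [(this _).last, Finset.smul_sum]
        bal := fun s x a l => by simp only [(this _).bal] }
    convert e.sum (z (c :: p)) using 3
    exact add_add_add_comm _ _ _ _

theorem HasDeg.homotopyPull {e : ℤ} (hφ : HasDeg 1 φ) (hh : HasDeg 0 h) (hψ : HasDeg 1 ψ)
    (hφ0 : φ [] = 0) (hh0 : h [] = 0) {F : List B → N} (hm : MAdd F)
    (hF : HasDeg e F) : HasDeg (e - 1) (AInf.homotopyPull φ h ψ F) := by
  intro l js hl
  induction hn : l.length using Nat.strong_induction_on generalizing l js e F with
  | _ n ih =>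
  cases hl with
  | nil => rw [homotopyPull_nil hh0 hm]; exact zero_mem _
  | @cons a j l js ha hl =>
    rw [homotopyPull_cons hφ0 hh0 hm]
    refine cuts_mem _ fun p q hpq => ?_
    subst hpq
    obtain ⟨j₁, j₂, rfl, h₁, h₂⟩ := forall₂_split hl
    -- Fixing a first entry of degree `i` adds `i` to the constant and subtracts `1`, since the list
    -- that remains is one shorter.
    have hcons : ∀ {b : B} {i : ℤ}, b ∈ gr i → HasDeg (e - 1 + i) fun l' => F (b :: l') :=
      fun hb l' js' hl' => gr_cast (hF _ _ (.cons hb hl')) (by simp; ring)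
    have hb := hh (a :: p) (j :: j₁) (.cons ha h₁)
    have hb' := eb_mem (hφ (a :: p) (j :: j₁) (.cons ha h₁))
    refine add_mem (gr_cast (hψ.pull (hcons hb) q j₂ h₂) ?_)
      (gr_cast (ih q.length (by subst hn; simp) (hm.cons _) (hcons hb') q j₂ h₂ rfl) ?_)
    · subst hn
      simp
      ring
    · subst hn
      simp
      ring

/-- The `eb` on the module variable is the sign of moving the odd map `h` past it. -/
theorem IsModFamily.barHomotopy (hφ : IsAlgFamily S 1 φ) (hh : IsAlgFamily S 0 h)
    (hψ : IsAlgFamily S 1 ψ) {f : Y → List B → N} (hf : IsModFamily S d f) :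
    IsModFamily S (d - 1) fun x l => AInf.homotopyPull φ h ψ (f (eb x)) l where
  fst := (hf.fst.homotopyPull hφ hh hf.mAdd).comp_eb
  slot x := slot_homotopyPull hφ hh hψ (hf.slot (eb x))
  deg j x hx := by
    have := hφ.deg.homotopyPull hh.deg hψ.deg hφ.nil hh.nil (hf.mAdd _) (hf.deg j _ (eb_mem hx))
    rwa [add_sub_assoc] at this

end HomotopyClosure

/-! ### The homotopy between two restrictions of a family -/

section ModHomotopy

variable {S : Type*} [Ring S]
variable {A B K M N : Type*} [AddCommGroup A] [Module S A] [Module Sᵐᵒᵖ A] [ZGraded A]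
  [AddCommGroup B] [Module S B] [Module Sᵐᵒᵖ B] [ZGraded B]
  [AddCommGroup K] [Module Sᵐᵒᵖ K] [ZGraded K]
  [AddCommGroup M] [Module Sᵐᵒᵖ M] [ZGraded M] [AddCommGroup N] [Module Sᵐᵒᵖ N] [ZGraded N]
  [IsGradedRight S A] [IsGradedLeft S A] [IsGradedRight S B] [IsGradedLeft S B]
  [IsGradedRight S K] [IsGradedRight S M] [IsGradedRight S N]

/-- The family `∑ ± f (id ⊗ φ ⊗ ⋯ ⊗ φ ⊗ h ⊗ ψ ⊗ ⋯ ⊗ ψ)`, for a family `f` of maps of module type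
and a homotopy `h` from `φ` to `ψ`. -/
noncomputable def modHomotopy (φ h ψ : List A → B) (f : M → List B → N) : M → List A → N :=
  twM fun x l => homotopyPull (twA φ) (twA h) (twA ψ) (twM f (eb x)) l

theorem twM_twM (f : M → List A → N) : twM (twM f) = f := by
  funext x l
  rw [twM, twM, theta_theta, theta_length, kos_kos, kos_congr (b := 0) (by simp), kos_zero]

theorem twM_modHomotopy (φ h ψ : List A → B) (f : M → List B → N) (x : M) (l : List A) :
    twM (modHomotopy φ h ψ f) x l
      = homotopyPull (twA φ) (twA h) (twA ψ) (twM f (eb x)) l := by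
  rw [modHomotopy, twM_twM]

variable {φ h ψ : List A → B}

theorem IsModFamily.modHomotopy {d : ℤ} (hφ : IsAlgFamily S 1 φ) (hh : IsAlgFamily S 0 h)
    (hψ : IsAlgFamily S 1 ψ) {f : M → List B → N} (hf : IsModFamily S d f) :
    IsModFamily S (d - 1) (AInf.modHomotopy φ h ψ f) :=
  (hf.twM.barHomotopy hφ.twA hh.twA hψ.twA).twM

theorem modHomotopy_neg (f : M → List B → N) :
    modHomotopy φ h ψ (-f) = -modHomotopy φ h ψ f := by
  funext x l
  exact (map_homotopyPull _ _ _ (-AddMonoidHom.id N) (twM f (eb (kos l.length x))) (theta l)).symm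

theorem modHomotopy_add (f g : M → List B → N) :
    modHomotopy φ h ψ (f + g) = modHomotopy φ h ψ f + modHomotopy φ h ψ g := by
  funext x l
  exact homotopyPull_add _ _ _ (twM f (eb (kos l.length x))) (twM g (eb (kos l.length x))) _

theorem modHomotopy_nil (hh : IsAlgFamily S 0 h) {d : ℤ} {f : M → List B → N}
    (hf : IsModFamily S d f) (x : M) : modHomotopy φ h ψ f x [] = 0 :=
  homotopyPull_nil hh.twA.nil (hf.twM.mAdd _)

theorem twM_modComp {d e : ℤ} {g : M → List A → N} {f : K → List A → M}
    (hg : IsModFamily S e g) (hf : IsModFamily S d f) (x : K) (l : List A) :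
    twM (modComp d g f) x l = cuts l fun p q => twM g (twM f x p) q :=
  twM_eq_of (f := modComp d g f) (g := fun y L => cuts L fun p q => twM g (twM f y p) q)
    (fun x l => modComp_eq hf.kos hg.fst.add x l) x l

theorem twM_modDiff {m : List A → A} (hm : IsAlgFamily S 2 m) {d : ℤ} {f : M → List A → N}
    (hf : IsModFamily S d f) (x : M) (l : List A) :
    twM (modDiff m d f) x l = sg (d + 1) • codiff (twA m) (twM f (eb x)) l :=
  twM_eq_of (f := modDiff m d f) (g := fun y L => sg (d + 1) • codiff (twA m) (twM f (eb y)) L)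
    (fun x l => modDiff_eq hf.mAdd hf.fst.add hm.mAdd hm.deg d x l) x l

theorem twM_modRestrict (hφ : IsAlgFamily S 1 φ) {d : ℤ} {f : M → List B → N}
    (hf : IsModFamily S d f) (x : M) (l : List A) :
    twM (modRestrict φ f) x l = pull (twA φ) (twM f x) l :=
  twM_eq_of (f := modRestrict φ f) (g := fun y L => pull (twA φ) (twM f y) L)
    (fun x l => modRestrict_eq hf.mAdd hφ.mAdd hφ.deg x l) x l

/-- Suspension is an involution, so identities between families may be checked on the sign-free
side. -/
theorem twM_injective {f g : M → List A → N} (e : ∀ x l, twM f x l = twM g x l) : f = g := by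
  rw [← twM_twM f, ← twM_twM g, show twM f = twM g from funext fun x => funext fun l => e x l]

/-- In a composition `u ↦ g (f x p) q` the homotopy acts either on the algebra variables consumed by
`f`, leaving `ψ` for those of `g`, or on those of `g`, leaving `φ` for those of `f`. In the second
case it moves past `f`, which gives the sign `(-1)^{df}`. -/
theorem modHomotopy_comp {dg df : ℤ} (hφ : IsAlgFamily S 1 φ) (hh : IsAlgFamily S 0 h)
    (hψ : IsAlgFamily S 1 ψ) {g : M → List B → N} (hg : IsModFamily S dg g)
    {f : K → List B → M} (hf : IsModFamily S df f) :
    modHomotopy φ h ψ (modComp df g f)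
      = modComp (df - 1) (modRestrict ψ g) (modHomotopy φ h ψ f)
        + sg df • modComp df (modHomotopy φ h ψ g) (modRestrict φ f) := by
  refine twM_injective fun x l => ?_
  have e : ∀ (F G : K → List A → N) (u : ℤˣ), twM (F + u • G) x l
      = twM F x l + u • twM G x l := fun _ _ _ => rfl
  rw [twM_modHomotopy, show twM (modComp df g f) (eb x)
    = fun L => cuts L fun p q => twM g (twM f (eb x) p) q from
      funext fun L => twM_modComp hg hf _ L, homotopyPull_cuts, cuts_add, e,
    twM_modComp (hg.restrict hψ) (hf.modHomotopy hφ hh hψ),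
    twM_modComp (hg.modHomotopy hφ hh hψ) (hf.restrict hφ), ← cuts_smul]
  congr 1
  · refine cuts_congr fun p q _ => ?_
    rw [twM_modHomotopy, twM_modRestrict hψ hg]
    let F : M →+ N := AddMonoidHom.mk' (fun z => pull (twA ψ) (twM g z) q) fun a b => by
      rw [← pull_add]
      exact pull_congr _ (fun w => hg.twM.fst.add a b w) q
    exact (map_homotopyPull _ _ _ F (twM f (eb x)) p).symm
  · refine cuts_congr fun p q _ => ?_
    rw [twM_modHomotopy, twM_modRestrict hφ hf]
    let F : M →+ N := AddMonoidHom.mk'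
      (fun z => homotopyPull (twA φ) (twA h) (twA ψ) (twM g (eb z)) q) fun a b => by
        rw [← homotopyPull_add, map_add]
        congr 1
        funext w
        exact hg.twM.fst.add _ _ w
    have h1 : ∀ u, homotopyPull (twA φ) (twA h) (twA ψ)
        (fun v => twM g (twM f (eb x) (u.map eb)) v) q = sg df • F (twM f x u) := by
      intro u
      rw [twM_eb hf]
      have : ∀ v, twM g (sg df • eb (twM f x u)) v
          = (DistribSMul.toAddMonoidHom N (sg df)) (twM g (eb (twM f x u)) v) := fun v =>
        map_sg (AddMonoidHom.mk' (fun z => twM g z v) fun a b => hg.twM.fst.add a b v) _ _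
      simp only [this, ← map_homotopyPull]
      rfl
    simp only [h1]
    exact (map_pull ((DistribSMul.toAddMonoidHom N (sg df)).comp F) (twA φ) (twM f x) p).symm

/-- A family with even constant, such as `m` or `h`, has odd degree after suspension and so
anticommutes with the sign operator; compare `twA_eb` for morphisms. -/
theorem twA_eb_neg {c : ℤ} (hc : Even c) {h : List A → B} (hh : IsAlgFamily S c h) (l : List A) :
    twA h (l.map eb) = -eb (twA h l) := by
  have h1 := hh.twA.mAdd.kos hh.twA.deg 1 l
  have h2 := hh.twA.mAdd.neg_map (kos 1) l []
  simp only [List.append_nil] at h2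
  rw [show l.map eb = l.map fun x => -kos 1 x from rfl, h2, eb, AddMonoidHom.neg_apply, neg_neg, h1]
  congr 1
  apply sg_congr
  obtain ⟨e, rfl⟩ := hc
  exact ⟨l.length - e, by ring⟩

theorem twM_modDiff_eq {m : List A → A} (hm : IsAlgFamily S 2 m) {d : ℤ}
    {f : M → List A → N} (hf : IsModFamily S d f) (x : M) :
    twM (modDiff m d f) x = fun l => sg (d + 1) • codiff (twA m) (twM f (eb x)) l :=
  funext fun l => twM_modDiff hm hf x l

/-- The chain homotopy formula `homotopyPull_codiff`, transported back along suspension. Only the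
differential of the algebras is involved; the operations of modules enter through
`modHomotopy_comp`. -/
theorem modHomotopy_diff {d : ℤ} (hφ : IsAlgFamily S 1 φ) (hh : IsAlgFamily S 0 h)
    (hψ : IsAlgFamily S 1 ψ) {m : List A → A} (hm : IsAlgFamily S 2 m) {m' : List B → B}
    (hm' : IsAlgFamily S 2 m') (hφc : ∀ l, algInsert m φ l = algComp m' φ l)
    (hψc : ∀ l, algInsert m ψ l = algComp m' ψ l)
    (hc : ∀ l, φ l - ψ l = algInsert m h l + algHomotopySum m' φ ψ h l)
    {f : M → List B → N} (hf : IsModFamily S d f) :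
    modDiff m (d - 1) (modHomotopy φ h ψ f)
      = modHomotopy φ h ψ (modDiff m' d f) + sg d • (modRestrict φ f - modRestrict ψ f) := by
  refine twM_injective fun x l => ?_
  have e : ∀ (F G G' : M → List A → N) (u : ℤˣ), twM (F + u • (G - G')) x l
      = twM F x l + u • (twM G x l - twM G' x l) := fun _ _ _ _ => rfl
  have hc' : ∀ l, twA φ l - twA ψ l = codiff (twA m) (twA h) l
      + homotopyPull (twA φ) (twA h) (twA ψ) (twA m') l := fun l => by
    have := hc (theta l)
    rwa [algHomotopySum_eq hm'.mAdd hφ.mAdd hφ.deg hψ.mAdd hψ.deg hh.mAdd hh.deg hh.nil,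
      show algInsert m h (theta l) = _ from (algInsert_eq hh.mAdd hm.mAdd hm.deg _).symm,
      theta_theta] at this
  have key := homotopyPull_codiff hφ.twA.nil hψ.twA.nil hh.twA.nil (twA_eb hφ) (twA_eb hψ)
    (twA_eb_neg (by decide) hh) (twA_eb_neg (by decide) hm') hm'.twA.mAdd hm'.twA.nil
    ((codiff_twA hφ hm hm').1 hφc) ((codiff_twA hψ hm hm').1 hψc) hc' (hf.twM.mAdd x) l
  rw [e, twM_modDiff hm (hf.modHomotopy hφ hh hψ), twM_modHomotopy, twM_modRestrict hφ hf,
    twM_modRestrict hψ hf, ← key, twM_modDiff_eq hm' hf]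
  have e1 : twM (modHomotopy φ h ψ f) (eb x)
      = homotopyPull (twA φ) (twA h) (twA ψ) (twM f x) := funext fun l => by
    rw [twM_modHomotopy, eb_eb]
  have e2 := map_homotopyPull (twA φ) (twA h) (twA ψ) (DistribSMul.toAddMonoidHom N (sg (d + 1)))
    (codiff (twA m') (twM f x)) l
  simp only [DistribSMul.toAddMonoidHom_apply] at e2
  -- The differentials in degrees `d - 1` and `d` carry opposite signs after suspension, which turns
  -- the difference of the two composites into the sum appearing in `key`.
  rw [e1, eb_eb, ← e2, sub_add_cancel, smul_add,
    show sg (d + 1) = -sg d from Int.negOnePow_succ d, Units.neg_smul]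
  abel

end ModHomotopy
/-! ### Inversion of unipotent families -/

section Unipotent

variable {S : Type*} [Ring S]
variable {A M N K : Type*} [AddCommGroup A] [Module S A] [Module Sᵐᵒᵖ A] [ZGraded A]
  [AddCommGroup M] [Module Sᵐᵒᵖ M] [ZGraded M] [AddCommGroup N] [Module Sᵐᵒᵖ N] [ZGraded N]
  [AddCommGroup K] [Module Sᵐᵒᵖ K] [ZGraded K]
  [IsGradedRight S A] [IsGradedLeft S A] [IsGradedRight S M] [IsGradedRight S N]
  [IsGradedRight S K]

/-- Each condition on a family involves lists of bounded length only, so it can be tested on an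
approximation `g n` with `n` beyond that bound. This is what allows infinite sums that are finite on
each list. -/
theorem IsModFamily.of_eq_on_length {d : ℤ} {f : M → List A → N} (g : ℕ → M → List A → N)
    (hg : ∀ n, IsModFamily S d (g n)) (e : ∀ n x l, l.length < n → f x l = g n x l) :
    IsModFamily S d f where
  fst := {
    add := fun x y l => by
      have := (hg (l.length + 1)).fst.add x y l
      rwa [← e _ _ _ (by simp), ← e _ _ _ (by simp), ← e _ _ _ (by simp)] at this
    last := fun s x => by
      have := (hg 1).fst.last s x
      rwa [← e _ _ _ (by simp), ← e _ _ _ (by simp)] at this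
    bal := fun s x a l => by
      have := (hg (l.length + 2)).fst.bal s x a l
      rwa [← e _ _ _ (by simp), ← e _ _ _ (by simp)] at this }
  slot x p := {
    add := fun a b l => by
      have := ((hg (p.length + l.length + 2)).slot x p).add a b l
      rwa [← e _ _ _ (by simp; omega), ← e _ _ _ (by simp; omega),
        ← e _ _ _ (by simp; omega)] at this
    last := fun s a => by
      have := ((hg (p.length + 2)).slot x p).last s a
      rwa [← e _ _ _ (by simp), ← e _ _ _ (by simp)] at this
    bal := fun s a b l => by
      have := ((hg (p.length + l.length + 3)).slot x p).bal s a b l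
      rwa [← e _ _ _ (by simp; omega), ← e _ _ _ (by simp; omega)] at this }
  deg j x hx l js hl := by
    rw [e (l.length + 1) x l (by simp)]
    exact (hg _).deg j x hx l js hl

/-- The powers of a family of degree `0` under composition. -/
noncomputable def modPow (u : M → List A → M) : ℕ → M → List A → M
  | 0 => idMod
  | n + 1 => modComp 0 (modPow u n) u

/-- The inverse `∑ uⁿ` of `id - u`, for a family `u` without first component. -/
noncomputable def modGeom (u : M → List A → M) (x : M) (l : List A) : M :=
  ∑ i ∈ Finset.range (l.length + 1), modPow u i x l

variable {u : M → List A → M}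

theorem isModFamily_modPow (hu : IsModFamily S 0 u) (n : ℕ) : IsModFamily S 0 (modPow u n) := by
  induction n with
  | zero => exact isModFamily_id
  | succ n ih => exact ih.comp hu

/-- Without a first component, every factor `u` consumes at least one algebra variable, so `n`
factors need at least `n` of them. -/
theorem modPow_eq_zero (hu : IsModFamily S 0 u) (h0 : ∀ x, u x [] = 0) (n : ℕ) (x : M)
    (l : List A) (hl : l.length < n) : modPow u n x l = 0 := by
  induction n generalizing x l with
  | zero => simp at hl
  | succ n ih =>
    rw [modPow, modComp]
    refine (cuts_congr (G' := fun _ _ => 0) fun p q hpq => ?_).trans (cuts_zero l)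
    cases p with
    | nil => rw [h0, (isModFamily_modPow hu n).map_zero, smul_zero]
    | cons a p =>
      rw [ih _ _ (by subst hpq; simp at hl; omega), smul_zero]

theorem modPow_succ' (hu : IsModFamily S 0 u) (n : ℕ) :
    modPow u (n + 1) = modComp 0 u (modPow u n) := by
  induction n with
  | zero => exact (modComp_id_left 0 u).trans (modComp_id_right hu).symm
  | succ n ih =>
    change modComp 0 (modPow u (n + 1)) u = modComp 0 u (modComp 0 (modPow u n) u)
    rw [ih, modComp_assoc 0 hu, zero_add]

/-- Any sufficiently long partial sum computes the series. The freedom in `n` lets all the sublists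
arising in a composition share one truncation. -/
theorem modGeom_eq (hu : IsModFamily S 0 u) (h0 : ∀ x, u x [] = 0) (n : ℕ) (x : M) (l : List A)
    (hl : l.length < n) : modGeom u x l = (∑ i ∈ Finset.range n, modPow u i) x l := by
  rw [Finset.sum_apply, Finset.sum_apply, modGeom]
  refine Finset.sum_subset (fun i => by simp; omega) fun i _ hi => modPow_eq_zero hu h0 _ _ _ ?_
  simpa using hi

theorem isModFamily_sum {ι : Type*} {d : ℤ} (s : Finset ι) {f : ι → M → List A → N}
    (hf : ∀ i, IsModFamily S d (f i)) : IsModFamily S d (∑ i ∈ s, f i) := by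
  classical
  induction s using Finset.induction_on with
  | empty => exact IsModFamily.zero
  | insert a s ha ih => rw [Finset.sum_insert ha]; exact (hf a).add ih

theorem isModFamily_modGeom (hu : IsModFamily S 0 u) (h0 : ∀ x, u x [] = 0) :
    IsModFamily S 0 (modGeom u) :=
  .of_eq_on_length _ (fun n => isModFamily_sum (Finset.range n) (isModFamily_modPow hu))
    (modGeom_eq hu h0)

theorem modGeom_eq_add_comp (hu : IsModFamily S 0 u) (h0 : ∀ x, u x [] = 0) :
    modGeom u = idMod + modComp 0 (modGeom u) u := by
  funext x l
  have e : modComp 0 (modGeom u) u x l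
      = modComp 0 (∑ i ∈ Finset.range (l.length + 1), modPow u i) u x l :=
    cuts_congr fun p q hpq => by
      rw [modGeom_eq hu h0 (l.length + 1)]
      subst hpq; simp
  have e' : ∀ n, modComp 0 (∑ i ∈ Finset.range n, modPow u i) u
      = ∑ i ∈ Finset.range n, modPow u (i + 1) := fun n => by
    induction n with
    | zero => funext x l; simp [modComp, cuts_zero]
    | succ n ih => rw [Finset.sum_range_succ, modComp_add_left, ih, Finset.sum_range_succ, modPow]
  -- One more power than necessary is included, so that splitting off the zeroth power leaves
  -- exactly the shifted sum from `e'`.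
  rw [Pi.add_apply, Pi.add_apply, e, e', modGeom_eq hu h0 (l.length + 2) x l (by omega),
    Finset.sum_range_succ', add_comm]
  rfl

theorem modGeom_eq_add_comp' (hu : IsModFamily S 0 u) (h0 : ∀ x, u x [] = 0) :
    modGeom u = idMod + modComp 0 u (modGeom u) := by
  funext x l
  have e : modComp 0 u (modGeom u) x l
      = modComp 0 u (∑ i ∈ Finset.range (l.length + 1), modPow u i) x l :=
    cuts_congr fun p q hpq => by
      rw [modGeom_eq hu h0 (l.length + 1)]
      subst hpq; simp
  have e' : ∀ n, modComp 0 u (∑ i ∈ Finset.range n, modPow u i)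
      = ∑ i ∈ Finset.range n, modPow u (i + 1) := fun n => by
    induction n with
    | zero => funext x l; simp [modComp, cuts_zero, hu.map_zero]
    | succ n ih =>
      rw [Finset.sum_range_succ, modComp_add_right 0 hu, ih, Finset.sum_range_succ,
        modPow_succ' hu]
  -- The same index shift as for composition on the other side.
  rw [Pi.add_apply, Pi.add_apply, e, e', modGeom_eq hu h0 (l.length + 2) x l (by omega),
    Finset.sum_range_succ', add_comm]
  rfl

theorem modGeom_comp (hu : IsModFamily S 0 u) (h0 : ∀ x, u x [] = 0) :
    modComp 0 (modGeom u) (idMod + -u) = idMod := by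
  have h := modGeom_eq_add_comp hu h0
  rw [modComp_add_right 0 (isModFamily_modGeom hu h0), modComp_neg_right 0
    (isModFamily_modGeom hu h0), modComp_id_right (isModFamily_modGeom hu h0)]
  nth_rw 1 [h]
  abel

theorem comp_modGeom (hu : IsModFamily S 0 u) (h0 : ∀ x, u x [] = 0) :
    modComp 0 (idMod + -u) (modGeom u) = idMod := by
  have h := modGeom_eq_add_comp' hu h0
  rw [modComp_add_left, modComp_neg_left, modComp_id_left]
  nth_rw 1 [h]
  abel

end Unipotent

/-! ### Inverses of morphisms of modules -/

section Inverse

variable {k : Type uk} {S : Type us} [Field k] [Ring S] [Algebra k S]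
variable {A : AInfAlg.{uk, us, ua} k S} {B : AInfAlg.{uk, us, ub} k S}

/-- A family inverse to a morphism of modules is a morphism. -/
theorem inverse_eq_zero {M N : AInfMod.{uk, us, ua, w} A} (t : AInfModHom M N)
    {s : N.carrier → List A.carrier → M.carrier} (hs : IsModFamily S 0 s)
    (hst : modComp 0 s t.f = idMod) (hts : modComp 0 t.f s = idMod) :
    modDiff A.m 0 s + modComp 0 M.m s - modComp 1 s N.m = 0 := by
  -- The Leibniz rule for `t ∘ s = id` expresses `t ∘ δ(s)` through `δ(t) ∘ s`, as `δ(id) = 0`.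
  -- Since `t` is a morphism this yields `t ∘ (δ(s) + m ∘ s) = m`, and composing with `s` on the
  -- left gives the equation for `s`.
  have h := modDiff_comp A.isFamily t.isFamily hs
  have e1 := modComp_assoc 0 (dg := 1) (g := M.m) (f := s) t.isFamily
  have e2 := modComp_assoc 0 (dg := 0) (g := t.f) (f := s) N.isFamily
  simp only [zero_add, sg, Int.negOnePow_zero, one_smul] at h e1 e2
  rw [hts, modDiff_id, t.diff, modComp_add_left, modComp_neg_left, e1, e2, hts,
    modComp_id_right N.isFamily] at h
  have h1 : modComp 1 t.f (modDiff A.m 0 s + modComp 0 M.m s) = N.m := by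
    rw [modComp_add_right 1 t.isFamily, ← sub_eq_zero, h]
    abel
  have e3 := modComp_assoc 1 (dg := 0) (g := t.f) (f := modDiff A.m 0 s + modComp 0 M.m s) hs
  rw [add_zero, hst, modComp_id_left, h1] at e3
  rw [e3, sub_self]

end Inverse

/-! ### Homotopic morphisms induce isomorphic restriction functors -/

section Comparison

variable {k : Type uk} {S : Type us} [Field k] [Ring S] [Algebra k S]
variable {A : AInfAlg.{uk, us, ua} k S} {B : AInfAlg.{uk, us, ub} k S}

/-- `h` is a homotopy from `f` to `g`. -/
structure IsHomotopy (f g : AInfHom A B) (h : List A.carrier → B.carrier) : Prop where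
  isFamily : IsAlgFamily S 0 h
  eq : ∀ l, f.f l - g.f l = algInsert A.m h l + algHomotopySum B.m f.f g.f h l

variable {f g : AInfHom A B} {h : List A.carrier → B.carrier}

theorem IsHomotopy.modDiff (H : IsHomotopy f g h) {M N : AInfMod.{uk, us, ub, w} B} {d : ℤ}
    {u : M.carrier → List B.carrier → N.carrier} (hu : IsModFamily S d u) :
    modDiff A.m (d - 1) (modHomotopy f.f h g.f u)
      = modHomotopy f.f h g.f (AInf.modDiff B.m d u)
        + sg d • (modRestrict f.f u - modRestrict g.f u) :=
  modHomotopy_diff f.isFamily H.isFamily g.isFamily A.isFamily B.isFamily f.map_m g.map_m H.eq hu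

theorem IsHomotopy.modComp (H : IsHomotopy f g h) {L M N : AInfMod.{uk, us, ub, w} B} {d e : ℤ}
    {v : M.carrier → List B.carrier → N.carrier} (hv : IsModFamily S e v)
    {u : L.carrier → List B.carrier → M.carrier} (hu : IsModFamily S d u) :
    modHomotopy f.f h g.f (modComp d v u)
      = AInf.modComp (d - 1) (modRestrict g.f v) (modHomotopy f.f h g.f u)
        + sg d • AInf.modComp d (modHomotopy f.f h g.f v) (modRestrict f.f u) :=
  modHomotopy_comp f.isFamily H.isFamily g.isFamily hv hu

theorem IsHomotopy.isModFamily (H : IsHomotopy f g h) (M : AInfMod.{uk, us, ub, w} B) :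
    IsModFamily S 0 (modHomotopy f.f h g.f M.m) :=
  M.isFamily.modHomotopy f.isFamily H.isFamily g.isFamily

theorem IsHomotopy.modHomotopy_nil (H : IsHomotopy f g h) (M : AInfMod.{uk, us, ub, w} B)
    (x : M.carrier) : modHomotopy f.f h g.f M.m x [] = 0 :=
  AInf.modHomotopy_nil H.isFamily M.isFamily x

/-- The family `id - M(h)`, a comparison between the restrictions of `M`. -/
noncomputable def comparison (f g : AInfHom A B) (h : List A.carrier → B.carrier)
    (M : AInfMod.{uk, us, ub, w} B) : M.carrier → List A.carrier → M.carrier :=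
  idMod + -modHomotopy f.f h g.f M.m

theorem IsHomotopy.comparison_isModFamily (H : IsHomotopy f g h) (M : AInfMod.{uk, us, ub, w} B) :
    IsModFamily S 0 (comparison f g h M) :=
  IsModFamily.add isModFamily_id (H.isModFamily M).neg

/-- The chain homotopy formula for the operations `m`, with `δ(m)` replaced by `-m ∘ m` and the
Leibniz rule applied to `m ∘ m`. The terms `R_f m` and `R_g m` come from the identity part of the
comparison. -/
theorem IsHomotopy.comparison_eq_zero (H : IsHomotopy f g h) (M : AInfMod.{uk, us, ub, w} B) :
    AInf.modDiff A.m 0 (comparison f g h M)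
      + AInf.modComp 0 (modRestrict g.f M.m) (comparison f g h M)
      - AInf.modComp 1 (comparison f g h M) (modRestrict f.f M.m) = 0 := by
  have h1 := H.modDiff M.isFamily
  have h2 : AInf.modDiff B.m 1 M.m = -AInf.modComp 1 M.m M.m :=
    eq_neg_of_add_eq_zero_left M.eq_zero
  have h3 := H.modComp M.isFamily M.isFamily
  rw [h2, modHomotopy_neg, h3] at h1
  simp only [sub_self, sg, Int.negOnePow_one, Units.neg_smul, one_smul] at h1
  have hg := M.isFamily.restrict g.isFamily
  rw [comparison, modDiff_add, modDiff_id, modDiff_neg, h1, modComp_add_right 0 hg,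
    modComp_id_right hg, modComp_neg_right 0 hg, modComp_add_left, modComp_id_left,
    modComp_neg_left]
  abel

/-- The same two formulas applied to `t` with `δ(t) = t ∘ m - m ∘ t`: the Leibniz rule yields the
composites of `H(t)` with the operations as well as those of `t` with `H(m)`. -/
theorem IsHomotopy.comparison_natural (H : IsHomotopy f g h) {M N : AInfMod.{uk, us, ub, w} B}
    (t : AInfModHom M N) :
    AInf.modComp 0 (comparison f g h N) (modRestrict f.f t.f)
      - AInf.modComp 0 (modRestrict g.f t.f) (comparison f g h M)
      = AInf.modDiff A.m (-1) (modHomotopy f.f h g.f t.f)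
        + AInf.modComp (-1) (modRestrict g.f N.m) (modHomotopy f.f h g.f t.f)
        + AInf.modComp 1 (modHomotopy f.f h g.f t.f) (modRestrict f.f M.m) := by
  have h1 := H.modDiff t.isFamily
  have h2 := H.modComp t.isFamily M.isFamily
  have h3 := H.modComp N.isFamily t.isFamily
  have hg := t.isFamily.restrict g.isFamily
  rw [t.diff, modHomotopy_add, modHomotopy_neg, h2, h3] at h1
  simp only [zero_sub, sub_self, sg, Int.negOnePow_one, Int.negOnePow_zero, Units.neg_smul,
    one_smul] at h1
  rw [h1, comparison, comparison, modComp_add_left, modComp_id_left, modComp_neg_left,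
    modComp_add_right 0 hg, modComp_id_right hg, modComp_neg_right 0 hg]
  abel

theorem IsHomotopy.modGeom_comp (H : IsHomotopy f g h) (M : AInfMod.{uk, us, ub, w} B) :
    AInf.modComp 0 (modGeom (modHomotopy f.f h g.f M.m)) (comparison f g h M) = idMod :=
  AInf.modGeom_comp (H.isModFamily M) (H.modHomotopy_nil M)

theorem IsHomotopy.comp_modGeom (H : IsHomotopy f g h) (M : AInfMod.{uk, us, ub, w} B) :
    AInf.modComp 0 (comparison f g h M) (modGeom (modHomotopy f.f h g.f M.m)) = idMod :=
  AInf.comp_modGeom (H.isModFamily M) (H.modHomotopy_nil M)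

theorem IsHomotopy.isModFamily_modGeom (H : IsHomotopy f g h) (M : AInfMod.{uk, us, ub, w} B) :
    IsModFamily S 0 (modGeom (modHomotopy f.f h g.f M.m)) :=
  AInf.isModFamily_modGeom (H.isModFamily M) (H.modHomotopy_nil M)

/-- The comparison morphism from the restriction of `M` along `f` to its restriction along `g`. -/
noncomputable def IsHomotopy.hom (H : IsHomotopy f g h) (M : AInfMod.{uk, us, ub, w} B) :
    AInfModHom (M.restrict f) (M.restrict g) where
  f := comparison f g h M
  isFamily := H.comparison_isModFamily M
  eq_zero := H.comparison_eq_zero M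

/-- The inverse of the comparison morphism. -/
noncomputable def IsHomotopy.inv (H : IsHomotopy f g h) (M : AInfMod.{uk, us, ub, w} B) :
    AInfModHom (M.restrict g) (M.restrict f) where
  f := modGeom (modHomotopy f.f h g.f M.m)
  isFamily := H.isModFamily_modGeom M
  eq_zero := inverse_eq_zero (H.hom M) (H.isModFamily_modGeom M) (H.modGeom_comp M)
    (H.comp_modGeom M)

/-- The comparison isomorphism between the restrictions of `M` along homotopic morphisms. -/
noncomputable def IsHomotopy.iso (H : IsHomotopy f g h) (M : AInfMod.{uk, us, ub, w} B) :
    (restrict.{uk, us, ua, ub, w} f).obj M ≅ (restrict.{uk, us, ua, ub, w} g).obj M where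
  hom := H.hom M
  inv := H.inv M
  hom_inv_id := AInfModHom.ext (H.modGeom_comp M)
  inv_hom_id := AInfModHom.ext (H.comp_modGeom M)

/-- The comparison isomorphisms are natural up to homotopy. -/
theorem IsHomotopy.natural (H : IsHomotopy f g h) {M N : AInfMod.{uk, us, ub, w} B}
    (t : M ⟶ N) :
    homotopyRel A ((restrict f).map t ≫ (H.iso N).hom) ((H.iso M).hom ≫ (restrict g).map t) :=
  ⟨modHomotopy f.f h g.f (AInfModHom.f t),
    (AInfModHom.isFamily t).modHomotopy f.isFamily H.isFamily g.isFamily, H.comparison_natural t⟩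

/-- Homotopic morphisms induce isomorphic functors between the homotopy categories. -/
theorem AInfHom.Homotopic.nonempty_iso (e : f.Homotopic g) :
    Nonempty (hoRestrict.{uk, us, ua, ub, w} f ≅ hoRestrict.{uk, us, ua, ub, w} g) := by
  obtain ⟨h, hh, e⟩ := e
  have H : IsHomotopy f g h := ⟨hh, e⟩
  refine ⟨NatIso.ofComponents
    (fun M => (CategoryTheory.Quotient.functor _).mapIso (H.iso M.as)) ?_⟩
  rintro ⟨M⟩ ⟨N⟩ t
  obtain ⟨t, rfl⟩ := (CategoryTheory.Quotient.functor _).map_surjective t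
  -- The naturality square commutes only up to the homotopy `H(t)`; this is where passing to
  -- homotopy classes is needed.
  exact CategoryTheory.Quotient.sound _ (H.natural t)

end Comparison

/-! ### Functoriality of restriction -/

section Functoriality

variable {k : Type uk} {S : Type us} [Field k] [Ring S] [Algebra k S]
variable {A : AInfAlg.{uk, us, ua} k S} {B : AInfAlg.{uk, us, ub} k S}
  {C : AInfAlg.{uk, us, uc} k S}

/-- Only the cut into blocks of length one survives, the identity family being zero elsewhere. -/
theorem pull_idAlg {X V : Type*} [AddCommGroup X] [ZGraded X] [AddCommGroup V] {F : List X → V} (hF : MAdd F)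
    (l : List X) : pull idAlg F l = F l := by
  induction l generalizing F with
  | nil => exact pull_nil _ _
  | cons a l ih =>
    rw [pull_cons, cuts_first]
    · exact ih (hF.cons a)
    · intro p q hp
      cases p with
      | nil => exact absurd rfl hp
      | cons c p => exact hF.pull_zero_cons idAlg q

theorem twA_idAlg {X : Type*} [AddCommGroup X] [ZGraded X] : twA (idAlg : List X → X) = idAlg := by
  funext l
  match l with
  | [] => rfl
  | [a] => exact kos_zero a
  | _ :: _ :: _ => rfl

theorem modRestrict_idAlg {M N : AInfMod.{uk, us, ua, w} A} {d : ℤ}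
    {u : M.carrier → List A.carrier → N.carrier} (hu : IsModFamily S d u) :
    modRestrict idAlg u = u :=
  twM_injective fun x l => by
    rw [twM_modRestrict isAlgFamily_id hu, twA_idAlg, pull_idAlg (hu.twM.mAdd x)]

/-- After suspension, composing morphisms is composing coalgebra maps, so this is associativity of
precomposition, `pull_pull`. -/
theorem modRestrict_algComp (g : AInfHom B C) (f : AInfHom A B) {M N : AInfMod.{uk, us, uc, w} C}
    {d : ℤ} {u : M.carrier → List C.carrier → N.carrier} (hu : IsModFamily S d u) :
    modRestrict (algComp g.f f.f) u = modRestrict f.f (modRestrict g.f u) := by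
  refine twM_injective fun x l => ?_
  have e : twA (algComp g.f f.f) = pull (twA f.f) (twA g.f) := funext fun l => by
    rw [twA, algComp_eq g.isFamily.mAdd f.isFamily.mAdd f.isFamily.deg, theta_theta]
  have e' : twM (modRestrict g.f u) x = pull (twA g.f) (twM u x) := funext fun l =>
    twM_modRestrict g.isFamily hu x l
  rw [twM_modRestrict (f.isFamily.comp g.isFamily) hu, e,
    twM_modRestrict f.isFamily (hu.restrict g.isFamily), e', pull_pull (hu.twM.mAdd x)]

/-- Modules with equal operations on the same graded module are isomorphic by the identity. -/
def isoOfEq {X : GradedRightModule.{us, w} S} {m m' : X.carrier → List A.carrier → X.carrier}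
    (hm : IsModFamily S 1 m) (hm' : IsModFamily S 1 m')
    (e : modDiff A.m 1 m + modComp 1 m m = 0) (e' : modDiff A.m 1 m' + modComp 1 m' m' = 0)
    (h : m = m') : (⟨X, m, hm, e⟩ : AInfMod.{uk, us, ua, w} A) ≅ ⟨X, m', hm', e'⟩ where
  hom := {
    f := idMod
    isFamily := isModFamily_id
    eq_zero := by
      rw [modDiff_id, modComp_id_left, modComp_id_right hm']
      change 0 + m' - m = 0
      rw [h]
      abel }
  inv := {
    f := idMod
    isFamily := isModFamily_id
    eq_zero := by
      rw [modDiff_id, modComp_id_left, modComp_id_right hm]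
      change 0 + m - m' = 0
      rw [h]
      abel }
  hom_inv_id := AInfModHom.ext (modComp_id_left 0 idMod)
  inv_hom_id := AInfModHom.ext (modComp_id_left 0 idMod)

/-- Restriction along the identity is isomorphic to the identity functor. -/
noncomputable def restrictId (A : AInfAlg.{uk, us, ua} k S) :
    restrict.{uk, us, ua, ua, w} (AInfHom.id A) ≅ 𝟭 _ :=
  NatIso.ofComponents
    (fun M => isoOfEq (M.restrict (AInfHom.id A)).isFamily M.isFamily
      (M.restrict (AInfHom.id A)).eq_zero M.eq_zero (modRestrict_idAlg (M := M) (N := M) M.isFamily))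
    fun {M N} t => AInfModHom.ext (by
      have ht : IsModFamily S 0 t.f := t.isFamily
      change modComp 0 idMod (modRestrict idAlg t.f) = modComp 0 t.f idMod
      rw [modComp_id_left, modComp_id_right ht, modRestrict_idAlg ht])

/-- Restriction along a composition is isomorphic to the composition of the restrictions. -/
noncomputable def restrictComp (g : AInfHom B C) (f : AInfHom A B) :
    restrict.{uk, us, ua, uc, w} (g.comp f)
      ≅ restrict.{uk, us, ub, uc, w} g ⋙ restrict.{uk, us, ua, ub, w} f :=
  NatIso.ofComponents
    (fun M => isoOfEq (M.restrict (g.comp f)).isFamily ((M.restrict g).restrict f).isFamily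
      (M.restrict (g.comp f)).eq_zero ((M.restrict g).restrict f).eq_zero
      (modRestrict_algComp (M := M) (N := M) g f M.isFamily))
    fun {M N} t => AInfModHom.ext (by
      have ht : IsModFamily S 0 t.f := t.isFamily
      change modComp 0 idMod (modRestrict (algComp g.f f.f) t.f)
        = modComp 0 (modRestrict f.f (modRestrict g.f t.f)) idMod
      rw [modComp_id_left, modComp_id_right ((ht.restrict g.isFamily).restrict f.isFamily),
        modRestrict_algComp g f ht])

/-- Restriction to the homotopy categories along the identity. -/
noncomputable def hoRestrictId (A : AInfAlg.{uk, us, ua} k S) :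
    hoRestrict.{uk, us, ua, ua, w} (AInfHom.id A) ≅ 𝟭 _ :=
  NatIso.ofComponents
    (fun M => (CategoryTheory.Quotient.functor _).mapIso ((restrictId A).app M.as)) (by
      rintro ⟨M⟩ ⟨N⟩ t
      obtain ⟨t, rfl⟩ := (CategoryTheory.Quotient.functor _).map_surjective t
      exact congrArg (CategoryTheory.Quotient.functor (homotopyRel A)).map
        ((restrictId A).hom.naturality t))

/-- Restriction to the homotopy categories along a composition. -/
noncomputable def hoRestrictComp (g : AInfHom B C) (f : AInfHom A B) :
    hoRestrict.{uk, us, ua, uc, w} (g.comp f)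
      ≅ hoRestrict.{uk, us, ub, uc, w} g ⋙ hoRestrict.{uk, us, ua, ub, w} f :=
  NatIso.ofComponents
    (fun M => (CategoryTheory.Quotient.functor _).mapIso ((restrictComp g f).app M.as)) (by
      rintro ⟨M⟩ ⟨N⟩ t
      obtain ⟨t, rfl⟩ := (CategoryTheory.Quotient.functor _).map_surjective t
      exact congrArg (CategoryTheory.Quotient.functor (homotopyRel A)).map
        ((restrictComp g f).hom.naturality t))

/-- A homotopy equivalence induces an equivalence of the homotopy categories. -/
theorem AInfHom.IsHomotopyEquivalence.isEquivalence {f : AInfHom A B}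
    (hf : f.IsHomotopyEquivalence) : (hoRestrict.{uk, us, ua, ub, w} f).IsEquivalence := by
  obtain ⟨g, hgf, hfg⟩ := hf
  obtain ⟨e⟩ := AInfHom.Homotopic.nonempty_iso.{uk, us, ua, ua, w} hgf
  obtain ⟨e'⟩ := AInfHom.Homotopic.nonempty_iso.{uk, us, ub, ub, w} hfg
  exact (CategoryTheory.Equivalence.mk (hoRestrict.{uk, us, ua, ub, w} f)
    (hoRestrict.{uk, us, ub, ua, w} g)
    -- Restriction reverses composition: `f ∘ g ∼ id` supplies the unit over `B`, and `g ∘ f ∼ id`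
    -- the counit over `A`.
    ((hoRestrictId B).symm ≪≫ e'.symm ≪≫ hoRestrictComp f g)
    ((hoRestrictComp g f).symm ≪≫ e ≪≫ hoRestrictId A)).isEquivalence_functor

end Functoriality

end AInf

/-! ### Invariance of the homotopy category of modules -/

theorem mainTheorem12 {k : Type uk} {S : Type us} [Field k] [Ring S]
    [Algebra k S] [FiniteDimensional k S] [IsSemisimpleRing S]
    [IsSemisimpleRing (TensorProduct k S Sᵐᵒᵖ)]
    (A : AInf.AInfAlg.{uk, us, ua} k S) (B : AInf.AInfAlg.{uk, us, ub} k S) :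
    (∀ f g : AInf.AInfHom A B, f.Homotopic g →
      Nonempty (AInf.hoRestrict.{uk, us, ua, ub, w} f ≅ AInf.hoRestrict.{uk, us, ua, ub, w} g)) ∧
    (∀ f : AInf.AInfHom A B, f.IsHomotopyEquivalence →
      (AInf.hoRestrict.{uk, us, ua, ub, w} f).IsEquivalence) :=
  ⟨fun _ _ h => h.nonempty_iso, fun _ h => h.isEquivalence⟩
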